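/- Let $K$ be a field, let $A=\{u_1,\dots,u_n\}$ be a set of $n$ distinct monomials of the same degree $\delta>0$ in $K[t_1,\dots,t_d]$, let $K[A]=K[u_1,\dots,u_n]$ be the toric ring, and let $I_A$ be its toric ideal, the kernel of $K[x_1,\dots,x_n]\to K[A]$, $x_i\mapsto u_i$. Call $K[A]$ \emph{strongly Koszul} if $u_1,\dots,u_n$ is a minimal system of generators of the graded maximal ideal of $K[A]$ such that for all $1\le i_1<\dots<i_r\le n$ and all $1\le s\le r$ the colon ideal $(u_{i_1},\dots,u_{i_{s-1}}):u_{i_s}$ of $K[A]$ is generated by a subset of $\{u_1,\dots,u_n\}$. Call $K[A]$ \emph{squarefree} if it is isomorphic as a $K$-algebra to a semigroup ring generated by finitely many squarefree monomials. For an ordering $<$ of the variables $x_1,\dots,x_n$, let $<_{\rm rlex}$ be the (graded) reverse lexicographic order induced by it, let ${\rm in}_{<_{\rm rlex}}(I_A)$ be the corresponding initial ideal, and let $G(J)$ denote the minimal set of monomial generators of a monomial ideal $J$. Suppose that $K[A]$ is squarefree. (1) Suppose that $K[A]$ is strongly Koszul. Let $1\le i<j\le n$, and let $<$ be any ordering of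 the variables satisfying $$x_j<x_i<\{x_k \mid u_iu_k/u_j\in K[A],\ k\ne j\}<\text{ all other variables}.$$ Then every monomial in $G({\rm in}_{<_{\rm rlex}}(I_A))\cap(x_i)$ is quadratic. (2) Consequently, $K[A]$ is strongly Koszul if and only if for all $1\le i<j\le n$ there is an ordering $x_{i_1}<x_{i_2}<\dots<x_{i_n}$ of the variables with $\{i_1,i_2\}=\{i,j\}$ such that every monomial in $G({\rm in}_{<_{\rm rlex}}(I_A))\cap(x_{i_2})$ is quadratic. -/

import Mathlib

open MvPolynomial

namespace StronglyKoszulToric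

/-! ### The reverse lexicographic order -/

section RevLex

variable {n : ℕ}

/-- Copy of the exponent vectors `Fin n →₀ ℕ`, to carry the (graded) reverse lexicographic order
induced by an ordering of the variables. The ordering is given by `ρ : Equiv.Perm (Fin n)`, where
`ρ k` is the position of `x_k`, counted from the smallest variable: `x_k < x_l` iff `ρ k < ρ l`. -/
@[ext]
structure RevLex (ρ : Equiv.Perm (Fin n)) : Type where
  exps : Fin n →₀ ℕ

namespace RevLex

variable (ρ : Equiv.Perm (Fin n))

/-- The identification of `RevLex ρ` with `Fin n →₀ ℕ`. -/
def equiv : RevLex ρ ≃ (Fin n →₀ ℕ) := ⟨exps, mk, fun _ => rfl, fun _ => rfl⟩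

noncomputable instance : AddCommMonoid (RevLex ρ) := (equiv ρ).addCommMonoid

theorem exps_add (a b : RevLex ρ) : (a + b).exps = a.exps + b.exps := rfl

/-- The total degree of an exponent vector, followed by its exponents listed from the smallest
variable to the largest one, with the order on the exponents reversed. -/
noncomputable def key (a : RevLex ρ) : ℕ ×ₗ Lex (Fin n → ℕᵒᵈ) :=
  toLex (a.exps.degree, toLex fun p => OrderDual.toDual (a.exps (ρ.symm p)))

theorem key_injective : Function.Injective (key ρ) := by
  intro a b h
  have h1 := (Prod.mk.inj (toLex.injective h)).2
  have h2 := toLex.injective h1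
  ext k
  simpa using congrFun h2 (ρ k)

noncomputable instance : LinearOrder (RevLex ρ) :=
  LinearOrder.lift' (key ρ) (key_injective ρ)

/-- `a` is smaller than `b` iff it has smaller degree, or the degrees agree and, for the smallest
variable at which the exponents differ, the exponent in `a` is the larger one. -/
theorem lt_iff (a b : RevLex ρ) :
    a < b ↔ a.exps.degree < b.exps.degree ∨ a.exps.degree = b.exps.degree ∧
      ∃ k, (∀ l, ρ l < ρ k → a.exps l = b.exps l) ∧ b.exps k < a.exps k := by
  have : a < b ↔ key ρ a < key ρ b := Iff.rfl
  rw [this, key, key, Prod.Lex.toLex_lt_toLex]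
  refine or_congr Iff.rfl (and_congr Iff.rfl ?_)
  constructor
  · rintro ⟨p, h1, h2⟩
    refine ⟨ρ.symm p, fun l hl => ?_, h2⟩
    have := h1 (ρ l) (by simpa using hl)
    simpa using this
  · rintro ⟨k, h1, h2⟩
    refine ⟨ρ k, fun p hp => ?_, ?_⟩
    · have := h1 (ρ.symm p) (by
        have hp' : p < ρ k := hp
        simpa using hp')
      simpa using this
    · change OrderDual.toDual (a.exps (ρ.symm (ρ k))) < OrderDual.toDual (b.exps (ρ.symm (ρ k)))
      simpa using h2

instance : IsOrderedAddMonoid (RevLex ρ) where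
  add_le_add_left a b hab c := by
    rcases hab.eq_or_lt with rfl | h
    · exact le_rfl
    · refine le_of_lt ?_
      rw [lt_iff] at h ⊢
      simpa [exps_add] using h

theorem mk_monotone : Monotone (mk : (Fin n →₀ ℕ) → RevLex ρ) := by
  intro a b h
  obtain ⟨c, rfl⟩ := exists_add_of_le h
  rcases eq_or_ne c 0 with rfl | hc
  · rw [add_zero]
  · refine ((lt_iff ρ _ _).2 (Or.inl ?_)).le
    have : Finsupp.degree c ≠ 0 := by simpa [Finsupp.degree_eq_zero_iff] using hc
    simp only [map_add]
    omega

instance : WellFoundedLT (RevLex ρ) := by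
  refine ⟨RelEmbedding.wellFounded_iff_isEmpty.2 ⟨fun f => ?_⟩⟩
  obtain ⟨p, q, hpq, hle⟩ := wellQuasiOrdered_le (fun k => (f k).exps)
  have h1 : f q < f p := f.map_rel_iff.2 hpq
  exact absurd (mk_monotone ρ hle) (not_le_of_gt h1)

end RevLex

/-- The reverse lexicographic order induced by the ordering `ρ` of the variables. -/
noncomputable def revLex (ρ : Equiv.Perm (Fin n)) : MonomialOrder (Fin n) where
  syn := RevLex ρ
  toSyn := { toEquiv := (RevLex.equiv ρ).symm, map_add' := fun _ _ => rfl }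
  toSyn_monotone := fun _ _ h => RevLex.mk_monotone ρ h

end RevLex

/-! ### Initial ideals and minimal monomial generators -/

section Initial

variable {n : ℕ} {K : Type*} [Field K]

/-- The initial ideal of `I`. -/
noncomputable def initialIdeal (m : MonomialOrder (Fin n)) (I : Ideal (MvPolynomial (Fin n) K)) :
    Ideal (MvPolynomial (Fin n) K) :=
  Ideal.span (m.leadingTerm '' (I : Set (MvPolynomial (Fin n) K)))

/-- `G(J)`, the minimal set of monomial generators of a monomial ideal `J`: the monomials of `J`
that are minimal with respect to divisibility. -/
def minimalGenerators (J : Ideal (MvPolynomial (Fin n) K)) : Set (MvPolynomial (Fin n) K) :=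
  {g | ∃ e : Fin n →₀ ℕ, Minimal (fun e' => monomial e' (1 : K) ∈ J) e ∧ g = monomial e 1}

end Initial

/-! ### Toric rings -/

section Toric

variable {n d : ℕ} (K : Type*) [Field K]

/-- The monomial `u_i = t^{a_i}`. -/
noncomputable def gen (a : Fin n → Fin d →₀ ℕ) (i : Fin n) : MvPolynomial (Fin d) K :=
  monomial (a i) 1

/-- The toric ring `K[A] = K[u_1, …, u_n]`. -/
noncomputable def toricRing (a : Fin n → Fin d →₀ ℕ) : Subalgebra K (MvPolynomial (Fin d) K) :=
  Algebra.adjoin K (Set.range (gen K a))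

/-- The monomial `u_i` as an element of `K[A]`. -/
noncomputable def toricGen (a : Fin n → Fin d →₀ ℕ) (i : Fin n) : toricRing K a :=
  ⟨gen K a i, Algebra.subset_adjoin ⟨i, rfl⟩⟩

/-- The toric ideal `I_A`, the kernel of `x_i ↦ u_i`. -/
noncomputable def toricIdeal (a : Fin n → Fin d →₀ ℕ) : Ideal (MvPolynomial (Fin n) K) :=
  RingHom.ker (aeval (gen K a) : MvPolynomial (Fin n) K →ₐ[K] MvPolynomial (Fin d) K)

/-- The graded maximal ideal of `K[A]`: the elements with constant term zero. -/
noncomputable def gradedMaximalIdeal (a : Fin n → Fin d →₀ ℕ) : Ideal (toricRing K a) :=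
  (RingHom.ker (constantCoeff : MvPolynomial (Fin d) K →+* K)).comap (toricRing K a).val

/-- `u_1, …, u_n` is a minimal system of generators of `𝔪` such that, whenever
`i_1 < ⋯ < i_r`, the ideals `(u_{i_1}, …, u_{i_{j-1}}) : u_{i_j}` are generated by subsets of
`{u_1, …, u_n}`. -/
structure IsStronglyKoszulSystem {R : Type*} [CommRing R] (𝔪 : Ideal R) (u : Fin n → R) :
    Prop where
  span_eq : Ideal.span (Set.range u) = 𝔪
  minimal : ∀ k, u k ∉ Ideal.span (u '' {k}ᶜ)
  colon : ∀ (S : Set (Fin n)) (k : Fin n), (∀ s ∈ S, s < k) →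
    ∃ T : Set (Fin n), (Ideal.span (u '' S)).colon {u k} = Ideal.span (u '' T)

/-- `K[A]` is strongly Koszul (with respect to its monomial generators `u_1, …, u_n`). -/
def IsStronglyKoszul (a : Fin n → Fin d →₀ ℕ) : Prop :=
  IsStronglyKoszulSystem (gradedMaximalIdeal K a) (toricGen K a)

/-- `K[A]` is squarefree: it is isomorphic, as a `K`-algebra, to a semigroup ring generated by
squarefree monomials. -/
def IsSquarefreeToric (a : Fin n → Fin d →₀ ℕ) : Prop :=
  ∃ (N e : ℕ) (b : Fin N → Fin e →₀ ℕ), (∀ j s, b j s ≤ 1) ∧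
    Nonempty (toricRing K a ≃ₐ[K] toricRing K b)

/-- The set of all `k ≠ j` with `u_i u_k / u_j ∈ K[A]`. -/
def exchangeSet (a : Fin n → Fin d →₀ ℕ) (i j : Fin n) : Set (Fin n) :=
  {k | k ≠ j ∧ ∃ w ∈ toricRing K a, gen K a i * gen K a k = gen K a j * w}

/-- `x_j < x_i < {x_k | k ∈ exchangeSet} < all other variables`. -/
structure IsExchangeOrdering (a : Fin n → Fin d →₀ ℕ) (i j : Fin n) (ρ : Equiv.Perm (Fin n)) :
    Prop where
  lt : ρ j < ρ i
  lt_exchange : ∀ k ∈ exchangeSet K a i j, ρ i < ρ k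
  lt_other : ∀ l, l ≠ i → l ≠ j → l ∉ exchangeSet K a i j → ρ i < ρ l
  exchange_lt_other : ∀ k ∈ exchangeSet K a i j, ∀ l, l ≠ i → l ≠ j → l ∉ exchangeSet K a i j →
    ρ k < ρ l

/-- Every monomial in `G(in(I_A)) ∩ (x_i)` is quadratic, where the initial ideal is taken for the
reverse lexicographic order induced by `ρ`. -/
def QuadraticAt (a : Fin n → Fin d →₀ ℕ) (ρ : Equiv.Perm (Fin n)) (i : Fin n) : Prop :=
  ∀ g ∈ minimalGenerators (initialIdeal (revLex ρ) (toricIdeal K a)),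
    g ∈ Ideal.span {(X i : MvPolynomial (Fin n) K)} → g.totalDegree = 2

end Toric

end StronglyKoszulToric

/-! Because the u_i have one degree, strong Koszulness is equivalent to `ExchangeProperty`: for i ≠
j the ideal (u_i) : u_j is generated by some of the u_k. A monomial lies in the initial ideal
exactly when it is `Nonstandard`, so the theorem becomes one about exponent vectors.

For (1), let x_i x^α be a minimal nonstandard monomial. The order forces x_j to divide another
monomial with the same image, so u_i u^α ∈ (u_j), while u^α ∉ (u_j) because x^α is standard.
Exchange yields k in the exchange set with u^α ∈ (u_k). If x^α contains an exchange variable x_m,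
then x_i x_m is already nonstandard and is the whole generator. If it contains neither such a
variable nor x_i, rewriting u^α through x_k gives a smaller monomial than x^α, a contradiction. If
it contains x_i, then u_i² u^γ ∈ (u_j) descends to u_i u^γ = u^α ∈ (u_j), by `SquaresRigid`. In the
converse of (2), exchange is read off a quadratic generator dividing x_q x^α with x^α standard.

Squarefreeness serves only to prove `SquaresRigid`. The isomorphism with a squarefree ring K[B] need
not be graded, so a relation u_i² = u_k u_l is translated to the origin of K[B] and truncated to
linear parts; the dimension count in `disjoint_polyLE_map` shows that nothing is lost. The result is
f² = gh with g and h sums of squarefree monomials, so f is a scalar multiple of g, against the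
independence of the generators modulo the square of the maximal ideal. -/

open MvPolynomial

namespace StronglyKoszulToric

/-! ### The exchange property in the affine monoid. -/

section Monoid

variable {n d : ℕ}

/-- The affine monoid generated by the exponent vectors of the monomials. -/
noncomputable def expMonoid (a : Fin n → Fin d →₀ ℕ) : AddSubmonoid (Fin d →₀ ℕ) :=
  AddSubmonoid.closure (Set.range a)

/-- `w` lies in the translate of the affine monoid by the exponent `m`. -/
def MemShift (a : Fin n → Fin d →₀ ℕ) (m w : Fin d →₀ ℕ) : Prop :=
  ∃ v ∈ expMonoid a, w = m + v

theorem exp_mem (a : Fin n → Fin d →₀ ℕ) (i : Fin n) : a i ∈ expMonoid a :=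
  AddSubmonoid.subset_closure ⟨i, rfl⟩

theorem MemShift.mem {a : Fin n → Fin d →₀ ℕ} {i : Fin n} {w : Fin d →₀ ℕ}
    (h : MemShift a (a i) w) : w ∈ expMonoid a := by
  obtain ⟨v, hv, rfl⟩ := h
  exact add_mem (exp_mem a i) hv

theorem MemShift.add {a : Fin n → Fin d →₀ ℕ} {m w v : Fin d →₀ ℕ}
    (h : MemShift a m w) (hv : v ∈ expMonoid a) : MemShift a m (w + v) := by
  obtain ⟨x, hx, rfl⟩ := h
  exact ⟨x + v, add_mem hx hv, add_assoc _ _ _⟩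

theorem memShift_self (a : Fin n → Fin d →₀ ℕ) (m : Fin d →₀ ℕ) : MemShift a m m :=
  ⟨0, zero_mem _, (add_zero m).symm⟩

theorem eq_zero_or_memShift {a : Fin n → Fin d →₀ ℕ} {w : Fin d →₀ ℕ} (hw : w ∈ expMonoid a) :
    w = 0 ∨ ∃ i, MemShift a (a i) w := by
  induction hw using AddSubmonoid.closure_induction_left with
  | zero => exact Or.inl rfl
  | add_left x hx y hy ih =>
    obtain ⟨i, rfl⟩ := hx
    exact Or.inr ⟨i, y, hy, rfl⟩

theorem exists_eq_of_degree_eq {a : Fin n → Fin d →₀ ℕ} {δ : ℕ} (hδ : 0 < δ)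
    (hdeg : ∀ i, (a i).degree = δ) {w : Fin d →₀ ℕ} (hw : w ∈ expMonoid a) (h : w.degree = δ) :
    ∃ i, w = a i := by
  rcases eq_zero_or_memShift hw with rfl | ⟨i, v, hv, rfl⟩
  · simp at h; omega
  · refine ⟨i, ?_⟩
    rw [map_add, hdeg] at h
    have : v = 0 := by rw [← Finsupp.degree_eq_zero_iff]; omega
    simp [this]

/-- The monoid form of the statement that each ideal `(u_i) ∩ (u_j)` is generated in degree two. -/
def ExchangeProperty (a : Fin n → Fin d →₀ ℕ) : Prop :=
  ∀ i j, i ≠ j → ∀ w ∈ expMonoid a, MemShift a (a i) (w + a j) →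
    ∃ k l, MemShift a (a k) w ∧ a k + a j = a i + a l

/-- The equation w + a_j = a_i + w' is symmetric: the hypothesis applied to the cofactor w' factors
it, and cancelling a_j factors w. -/
theorem exchange_symm {a : Fin n → Fin d →₀ ℕ} {i j : Fin n}
    (h : ∀ w ∈ expMonoid a, MemShift a (a j) (w + a i) →
      ∃ k l, MemShift a (a k) w ∧ a k + a i = a j + a l) :
    ∀ w ∈ expMonoid a, MemShift a (a i) (w + a j) →
      ∃ k l, MemShift a (a k) w ∧ a k + a j = a i + a l := by
  rintro w hw ⟨w', hw', e⟩
  obtain ⟨k, l, ⟨x, hx, rfl⟩, e2⟩ := h w' hw' ⟨w, hw, by rw [add_comm, ← e, add_comm]⟩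
  refine ⟨l, k, ⟨x, hx, ?_⟩, by rw [add_comm, ← e2, add_comm]⟩
  have : a j + w = a j + (a l + x) := by
    rw [add_comm, e, ← add_assoc, ← add_assoc, ← e2, add_comm (a i)]
  exact add_left_cancel this

/-- Colon ideals of a principal ideal `(u_j)` by any monomial are generated by variables. -/
theorem ExchangeProperty.colon {a : Fin n → Fin d →₀ ℕ} (h : ExchangeProperty a)
    {v : Fin d →₀ ℕ} (hv : v ∈ expMonoid a) :
    ∀ (j : Fin n), ∀ w ∈ expMonoid a, MemShift a (a j) (w + v) →
      MemShift a (a j) v ∨ ∃ k, MemShift a (a k) w ∧ MemShift a (a j) (a k + v) := by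
  induction hv using AddSubmonoid.closure_induction_left with
  | zero =>
    intro j w _ hjw
    rw [add_zero] at hjw
    exact Or.inr ⟨j, hjw, by simpa using memShift_self a (a j)⟩
  | add_left x hx y hy ih =>
    obtain ⟨l, rfl⟩ := hx
    intro j w hw hjw
    by_cases hjl : j = l
    · subst hjl
      exact Or.inl ⟨y, hy, rfl⟩
    · have e : w + (a l + y) = w + y + a l := by abel
      rw [e] at hjw
      -- First take the colon by u_l, then by the rest y: the first step trades j for k, which is
      -- why the induction is uniform in j.
      obtain ⟨k, m, hk, hkm⟩ := h j l hjl (w + y) (add_mem hw hy) hjw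
      have key : ∀ z, MemShift a (a k) z → MemShift a (a j) (a l + z) := by
        rintro z ⟨z', hz', rfl⟩
        refine ⟨a m + z', add_mem (exp_mem a m) hz', ?_⟩
        rw [← add_assoc, ← add_assoc, ← hkm, add_comm (a l)]
      rcases ih k w hw hk with h1 | ⟨q, hq, hq'⟩
      · exact Or.inl (key _ h1)
      · refine Or.inr ⟨q, hq, ?_⟩
        have := key _ hq'
        rwa [add_left_comm] at this

/-- No square of a generator is a product of two generators in a different way. -/
def SquaresRigid (a : Fin n → Fin d →₀ ℕ) : Prop :=
  ∀ i k l, a i + a i = a k + a l → k = i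

/-- The ideal (u_j) : u^v is the whole ring or generated by some u_k. If such a u_k divides u_i²,
the cofactor is a generator by degree, and rigidity forces k = i. -/
theorem ExchangeProperty.memShift_of_double {a : Fin n → Fin d →₀ ℕ} (h : ExchangeProperty a)
    (hr : SquaresRigid a) {δ : ℕ} (hδ : 0 < δ) (hdeg : ∀ i, (a i).degree = δ) {i j : Fin n}
    {v : Fin d →₀ ℕ} (hv : v ∈ expMonoid a) (hw : MemShift a (a j) (a i + a i + v)) :
    MemShift a (a j) (a i + v) := by
  rcases h.colon hv j _ (add_mem (exp_mem a i) (exp_mem a i)) hw with h1 | ⟨k, ⟨w, hw, hk⟩, h2⟩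
  · rw [add_comm]
    exact h1.add (exp_mem a i)
  · obtain ⟨l, rfl⟩ := exists_eq_of_degree_eq hδ hdeg hw (by
      have := congrArg Finsupp.degree hk
      simp only [map_add, hdeg] at this
      omega)
    rw [hr i k l hk] at h2
    exact h2

end Monoid

/-! ### Monomial ideals of the toric ring and strong Koszulness. -/

section Ring

variable {n d : ℕ} {K : Type*} [Field K] {a : Fin n → Fin d →₀ ℕ}

theorem monomial_mem_toricRing {m : Fin d →₀ ℕ} (hm : m ∈ expMonoid a) (c : K) :
    monomial m c ∈ toricRing K a := by
  have h1 : (monomial m (1 : K)) ∈ toricRing K a := by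
    induction hm using AddSubmonoid.closure_induction with
    | mem x hx =>
      obtain ⟨i, rfl⟩ := hx
      exact Algebra.subset_adjoin ⟨i, rfl⟩
    | zero => exact one_mem _
    | add x y hx hy h1 h2 =>
      have := mul_mem h1 h2
      rwa [monomial_mul, one_mul] at this
  have := (toricRing K a).smul_mem h1 c
  rwa [smul_monomial, smul_eq_mul, mul_one] at this

theorem mem_toricRing_iff {f : MvPolynomial (Fin d) K} :
    f ∈ toricRing K a ↔ ∀ m ∈ f.support, m ∈ expMonoid a := by
  classical
  constructor
  · intro hf
    induction hf using Algebra.adjoin_induction with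
    | mem x hx =>
      obtain ⟨i, rfl⟩ := hx
      intro m hm
      rw [Finset.mem_singleton.1 (support_monomial_subset hm)]
      exact exp_mem a i
    | algebraMap r =>
      intro m hm
      rw [algebraMap_eq, C_apply] at hm
      rw [Finset.mem_singleton.1 (support_monomial_subset hm)]
      exact zero_mem _
    | add x y _ _ hx hy =>
      intro m hm
      rcases Finset.mem_union.1 (support_add hm) with h | h
      exacts [hx m h, hy m h]
    | mul x y _ _ hx hy =>
      intro m hm
      obtain ⟨p, hp, q, hq, rfl⟩ := Finset.mem_add.1 (support_mul x y hm)
      exact add_mem (hx p hp) (hy q hq)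
  · intro h
    rw [f.as_sum]
    exact sum_mem fun m hm => monomial_mem_toricRing (h m hm) _

/-- A monomial of the toric ring. -/
noncomputable def toricMonomial (K : Type*) [Field K] {m : Fin d →₀ ℕ} (hm : m ∈ expMonoid a) :
    toricRing K a :=
  ⟨monomial m 1, monomial_mem_toricRing hm 1⟩

@[simp]
theorem coe_toricMonomial {m : Fin d →₀ ℕ} (hm : m ∈ expMonoid a) :
    (toricMonomial K hm : MvPolynomial (Fin d) K) = monomial m 1 := rfl

theorem toricRing_eq_sum (f : toricRing K a) :
    f = ∑ m : f.1.support, f.1.coeff m • toricMonomial K (mem_toricRing_iff.1 f.2 m m.2) := by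
  apply Subtype.ext
  rw [AddSubmonoidClass.coe_finsetSum]
  simp only [SetLike.val_smul, coe_toricMonomial, smul_monomial, smul_eq_mul, mul_one]
  conv_lhs => rw [f.1.as_sum]
  exact (Finset.sum_coe_sort f.1.support fun m => monomial m (coeff m f.1)).symm

theorem toricMonomial_add {m m' : Fin d →₀ ℕ} (hm : m ∈ expMonoid a) (hm' : m' ∈ expMonoid a) :
    toricMonomial K (add_mem hm hm') = toricMonomial K hm * toricMonomial K hm' := by
  apply Subtype.ext
  simp [monomial_mul]

/-- A subspace of the toric ring contains every element whose monomials it contains. -/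
theorem mem_of_toricMonomial_mem {W : Submodule K (toricRing K a)} {f : toricRing K a}
    (h : ∀ m (hm : m ∈ expMonoid a), m ∈ f.1.support → toricMonomial K hm ∈ W) : f ∈ W := by
  rw [toricRing_eq_sum f]
  exact sum_mem fun m _ => W.smul_mem _ (h _ _ m.2)

theorem mem_ideal_of_toricMonomial_mem {I : Ideal (toricRing K a)} {f : toricRing K a}
    (h : ∀ m (hm : m ∈ expMonoid a), m ∈ f.1.support → toricMonomial K hm ∈ I) : f ∈ I :=
  mem_of_toricMonomial_mem (W := I.restrictScalars K) h

theorem mem_span_toricGen_iff {S : Set (Fin n)} {f : toricRing K a} :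
    f ∈ Ideal.span (toricGen K a '' S) ↔ ∀ m ∈ f.1.support, ∃ s ∈ S, MemShift a (a s) m := by
  classical
  constructor
  · intro hf
    induction hf using Submodule.span_induction with
    | mem x hx =>
      obtain ⟨s, hs, rfl⟩ := hx
      intro m hm
      rw [Finset.mem_singleton.1 (support_monomial_subset hm)]
      exact ⟨s, hs, memShift_self a _⟩
    | zero => simp
    | add x y _ _ hx hy =>
      intro m hm
      rcases Finset.mem_union.1 (support_add hm) with h | h
      exacts [hx m h, hy m h]
    | smul r x _ hx =>
      intro m hm
      obtain ⟨p, hp, q, hq, rfl⟩ := Finset.mem_add.1 (support_mul r.1 x.1 hm)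
      obtain ⟨s, hs, h⟩ := hx q hq
      refine ⟨s, hs, ?_⟩
      rw [add_comm]
      exact h.add (mem_toricRing_iff.1 r.2 p hp)
  · intro h
    refine mem_ideal_of_toricMonomial_mem fun m hm hmf => ?_
    obtain ⟨s, hs, v, hv, rfl⟩ := h m hmf
    have e : toricMonomial K hm = toricMonomial K hv * toricGen K a s := by
      apply Subtype.ext
      simp [toricGen, gen, monomial_mul, add_comm]
    rw [e]
    exact Ideal.mul_mem_left _ _ (Ideal.subset_span ⟨s, hs, rfl⟩)

theorem mem_colon_toricGen_iff {S : Set (Fin n)} {k : Fin n} {f : toricRing K a} :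
    f ∈ (Ideal.span (toricGen K a '' S)).colon {toricGen K a k} ↔
      ∀ m ∈ f.1.support, ∃ s ∈ S, MemShift a (a s) (m + a k) := by
  rw [Submodule.mem_colon_singleton, smul_eq_mul, mem_span_toricGen_iff]
  have e : ((f * toricGen K a k : toricRing K a) : MvPolynomial (Fin d) K) =
    f.1 * monomial (a k) 1 := rfl
  rw [e]
  constructor
  · intro h m hm
    refine h _ ?_
    rw [mem_support_iff, coeff_mul_monomial, mul_one]
    exact mem_support_iff.1 hm
  · intro h m hm
    classical
    obtain ⟨p, hp, q, hq, rfl⟩ := Finset.mem_add.1 (support_mul _ _ hm)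
    rw [Finset.mem_singleton.1 (support_monomial_subset hq)]
    exact h p hp

theorem support_toricMonomial {m : Fin d →₀ ℕ} (hm : m ∈ expMonoid a) :
    (toricMonomial K hm).1.support = {m} := by
  classical
  simp [support_monomial]

/-- Only colons (u_i) : u_j with i < j are needed, the other order following by symmetry; the
cofactor of a generator u_k of the colon has degree δ, so it is some u_l. -/
theorem IsStronglyKoszul.exchangeProperty {δ : ℕ} (hδ : 0 < δ) (hdeg : ∀ i, (a i).degree = δ)
    (h : IsStronglyKoszul K a) : ExchangeProperty a := by
  have key : ∀ i j, i < j → ∀ w ∈ expMonoid a, MemShift a (a i) (w + a j) →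
      ∃ k l, MemShift a (a k) w ∧ a k + a j = a i + a l := by
    intro i j hij w hw hs
    obtain ⟨T, hT⟩ := h.colon {i} j (by simpa using hij)
    have hiff : ∀ m ∈ expMonoid a, MemShift a (a i) (m + a j) ↔ ∃ t ∈ T, MemShift a (a t) m := by
      intro m hm
      have h1 := mem_colon_toricGen_iff (S := {i}) (k := j) (f := toricMonomial K hm)
      have h2 := mem_span_toricGen_iff (S := T) (f := toricMonomial K hm)
      rw [support_toricMonomial] at h1 h2
      rw [hT, h2] at h1
      simpa using h1.symm
    obtain ⟨k, hk, hkw⟩ := (hiff w hw).1 hs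
    obtain ⟨v, hv, hkv⟩ := (hiff (a k) (exp_mem a k)).2 ⟨k, hk, memShift_self a _⟩
    obtain ⟨l, rfl⟩ := exists_eq_of_degree_eq hδ hdeg hv (by
      have := congrArg Finsupp.degree hkv
      simp only [map_add, hdeg] at this
      omega)
    exact ⟨k, l, hkw, hkv⟩
  intro i j hij w hw hs
  rcases lt_or_gt_of_ne hij with h1 | h1
  · exact key i j h1 w hw hs
  · exact exchange_symm (key j i h1) w hw hs

/-- A monomial lies in a monomial ideal as soon as one generator divides it, so the colon by u_k is
the sum of the colons (u_s) : u_k, to each of which exchange applies. -/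
theorem isStronglyKoszul_of_exchangeProperty {δ : ℕ} (hδ : 0 < δ) (ha : Function.Injective a)
    (hdeg : ∀ i, (a i).degree = δ) (h : ExchangeProperty a) : IsStronglyKoszul K a where
  span_eq := by
    ext f
    rw [← Set.image_univ, mem_span_toricGen_iff]
    have e : f ∈ gradedMaximalIdeal K a ↔ coeff 0 f.1 = 0 := Iff.rfl
    rw [e]
    constructor
    · intro hf
      by_contra h0
      obtain ⟨s, -, v, -, hs⟩ := hf 0 (mem_support_iff.2 h0)
      have := congrArg Finsupp.degree hs
      simp only [map_add, hdeg, map_zero] at this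
      omega
    · intro hf m hm
      rcases eq_zero_or_memShift (mem_toricRing_iff.1 f.2 m hm) with rfl | ⟨i, hi⟩
      · exact absurd hf (mem_support_iff.1 hm)
      · exact ⟨i, trivial, hi⟩
  minimal k hk := by
    rw [mem_span_toricGen_iff] at hk
    obtain ⟨s, hs, v, hv, e⟩ := hk (a k) (by
      classical
      simp [toricGen, gen, support_monomial])
    have h1 := congrArg Finsupp.degree e
    simp only [map_add, hdeg] at h1
    have : v = 0 := by rw [← Finsupp.degree_eq_zero_iff]; omega
    rw [this, add_zero] at e
    exact hs (ha e).symm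
  colon S k hS := by
    refine ⟨{t | ∃ s ∈ S, MemShift a (a s) (a t + a k)}, ?_⟩
    ext f
    rw [mem_colon_toricGen_iff, mem_span_toricGen_iff]
    refine forall₂_congr fun m hm => ?_
    have hm' := mem_toricRing_iff.1 f.2 m hm
    constructor
    · rintro ⟨s, hs, hsm⟩
      obtain ⟨t, l, ht, e⟩ := h s k (hS s hs).ne m hm' hsm
      exact ⟨t, ⟨s, hs, a l, exp_mem a l, e⟩, ht⟩
    · rintro ⟨t, ⟨s, hs, hst⟩, ⟨v, hv, rfl⟩⟩
      refine ⟨s, hs, ?_⟩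
      rw [add_right_comm]
      exact hst.add hv

end Ring

/-! ### Standard monomials and quadratic generators. -/

section Standard

variable {n d : ℕ} {K : Type*} [Field K] {a : Fin n → Fin d →₀ ℕ}

/-- The exponent of the monomial `u^e`. -/
noncomputable def expMap (a : Fin n → Fin d →₀ ℕ) : (Fin n →₀ ℕ) →ₗ[ℕ] (Fin d →₀ ℕ) :=
  Finsupp.linearCombination ℕ a

@[simp]
theorem expMap_single (a : Fin n → Fin d →₀ ℕ) (i : Fin n) :
    expMap a (Finsupp.single i 1) = a i := by
  simp [expMap]

theorem mem_expMonoid_iff {w : Fin d →₀ ℕ} : w ∈ expMonoid a ↔ ∃ e, expMap a e = w := by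
  constructor
  · intro hw
    induction hw using AddSubmonoid.closure_induction with
    | mem x hx =>
      obtain ⟨i, rfl⟩ := hx
      exact ⟨_, expMap_single a i⟩
    | zero => exact ⟨0, map_zero _⟩
    | add x y _ _ h1 h2 =>
      obtain ⟨e, rfl⟩ := h1
      obtain ⟨e', rfl⟩ := h2
      exact ⟨e + e', map_add _ _ _⟩
  · rintro ⟨e, rfl⟩
    rw [expMap, Finsupp.linearCombination_apply]
    exact sum_mem fun i _ => AddSubmonoid.nsmul_mem _ (exp_mem a i) _

theorem expMap_mem (e : Fin n →₀ ℕ) : expMap a e ∈ expMonoid a := mem_expMonoid_iff.2 ⟨e, rfl⟩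

theorem memShift_iff_exists {i : Fin n} {w : Fin d →₀ ℕ} :
    MemShift a (a i) w ↔ ∃ e, w = expMap a (Finsupp.single i 1 + e) := by
  constructor
  · rintro ⟨v, hv, rfl⟩
    obtain ⟨e, rfl⟩ := mem_expMonoid_iff.1 hv
    exact ⟨e, by simp⟩
  · rintro ⟨e, rfl⟩
    exact ⟨expMap a e, expMap_mem e, by simp⟩

theorem exists_single_add {i : Fin n} {e : Fin n →₀ ℕ} (h : 0 < e i) :
    ∃ f, e = Finsupp.single i 1 + f :=
  exists_add_of_le (by
    rw [Finsupp.single_le_iff]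
    exact h)

theorem memShift_expMap {i : Fin n} {e : Fin n →₀ ℕ} (h : 0 < e i) :
    MemShift a (a i) (expMap a e) := by
  obtain ⟨f, rfl⟩ := exists_single_add h
  exact memShift_iff_exists.2 ⟨f, rfl⟩

theorem degree_expMap {δ : ℕ} (hdeg : ∀ i, (a i).degree = δ) (e : Fin n →₀ ℕ) :
    (expMap a e).degree = e.degree * δ := by
  induction e using Finsupp.induction_linear with
  | zero => simp
  | add f g hf hg => simp [hf, hg, add_mul]
  | single i c => simp [expMap, hdeg]

theorem aeval_gen_monomial (e : Fin n →₀ ℕ) (c : K) :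
    aeval (gen K a) (monomial e c) = monomial (expMap a e) c := by
  rw [aeval_monomial, algebraMap_eq]
  have : ∀ e : Fin n →₀ ℕ, (e.prod fun i k => gen K a i ^ k) = monomial (expMap a e) 1 := by
    intro e
    induction e using Finsupp.induction_linear with
    | zero => simp
    | add f g hf hg =>
      rw [Finsupp.prod_add_index' (by simp) (by intros; rw [pow_add]), hf, hg, monomial_mul,
        map_add, one_mul]
    | single i c => simp [expMap, gen, monomial_pow]
  rw [this, C_mul_monomial, mul_one]

/-- `x^e` is not a standard monomial: a smaller monomial has the same image in `K[A]`. -/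
def Nonstandard (a : Fin n → Fin d →₀ ℕ) (ρ : Equiv.Perm (Fin n)) (e : Fin n →₀ ℕ) : Prop :=
  ∃ e', expMap a e' = expMap a e ∧ (⟨e'⟩ : RevLex ρ) < ⟨e⟩

theorem RevLex.add_lt_add_iff_left {ρ : Equiv.Perm (Fin n)} (x e f : Fin n →₀ ℕ) :
    (⟨x + e⟩ : RevLex ρ) < ⟨x + f⟩ ↔ (⟨e⟩ : RevLex ρ) < ⟨f⟩ := by
  rw [RevLex.lt_iff, RevLex.lt_iff]
  simp

theorem Nonstandard.mono {ρ : Equiv.Perm (Fin n)} {e f : Fin n →₀ ℕ} (h : Nonstandard a ρ e)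
    (hef : e ≤ f) : Nonstandard a ρ f := by
  obtain ⟨x, rfl⟩ := exists_add_of_le hef
  obtain ⟨e', h1, h2⟩ := h
  refine ⟨x + e', by simp [h1, add_comm], ?_⟩
  rw [add_comm e x, RevLex.add_lt_add_iff_left]
  exact h2

/-- If the leading exponent were least in its fibre, no other monomial of f would share its image,
and its coefficient would survive in the image of f, which is 0. -/
theorem exists_lt_of_mem_toricIdeal {ρ : Equiv.Perm (Fin n)} {f : MvPolynomial (Fin n) K}
    (hf : f ∈ toricIdeal K a) (h0 : f ≠ 0) : Nonstandard a ρ ((revLex ρ).degree f) := by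
  classical
  by_contra hcon
  have hmem := (revLex ρ).degree_mem_support h0
  have hmax : ∀ e ∈ f.support, (⟨e⟩ : RevLex ρ) ≤ ⟨(revLex ρ).degree f⟩ :=
    fun e he => (revLex ρ).le_degree he
  have h1 : aeval (gen K a) f = 0 := hf
  have h2 : coeff (expMap a ((revLex ρ).degree f)) (aeval (gen K a) f) =
      coeff ((revLex ρ).degree f) f := by
    generalize (revLex ρ).degree f = e₀ at hcon hmem hmax
    conv_lhs => rw [f.as_sum, map_sum, coeff_sum]
    simp only [aeval_gen_monomial, coeff_monomial]
    rw [Finset.sum_eq_single_of_mem _ hmem]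
    · simp
    · intro e he hne
      rw [if_neg]
      intro heq
      refine hcon ⟨e, heq, lt_of_le_of_ne (hmax e he) ?_⟩
      intro h
      exact hne (congrArg RevLex.exps h)
  rw [h1, coeff_zero] at h2
  exact mem_support_iff.1 hmem h2.symm

theorem monomial_mem_initialIdeal_iff {ρ : Equiv.Perm (Fin n)} {e : Fin n →₀ ℕ} :
    monomial e (1 : K) ∈ initialIdeal (revLex ρ) (toricIdeal K a) ↔ Nonstandard a ρ e := by
  classical
  rw [initialIdeal, MonomialOrder.span_leadingTerm_eq_span_monomial']
  have himg : (fun p : MvPolynomial (Fin n) K => monomial ((revLex ρ).degree p) (1 : K)) ''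
      ((toricIdeal K a : Set (MvPolynomial (Fin n) K)) \ {0}) =
      (fun s => monomial s (1 : K)) '' ((revLex ρ).degree ''
        ((toricIdeal K a : Set (MvPolynomial (Fin n) K)) \ {0})) := by
    rw [Set.image_image]
  rw [himg, mem_ideal_span_monomial_image, support_monomial, if_neg one_ne_zero]
  simp only [Finset.mem_singleton, forall_eq]
  constructor
  · rintro ⟨_, ⟨f, ⟨hf, h0⟩, rfl⟩, hle⟩
    exact (exists_lt_of_mem_toricIdeal hf h0).mono hle
  · rintro ⟨e', h1, h2⟩
    have hlt : (revLex ρ).toSyn ((revLex ρ).degree (monomial e' (1 : K))) <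
        (revLex ρ).toSyn ((revLex ρ).degree (monomial e (1 : K))) := by
      rw [MonomialOrder.degree_monomial, MonomialOrder.degree_monomial, if_neg one_ne_zero,
        if_neg one_ne_zero]
      exact h2
    refine ⟨e, ⟨monomial e 1 - monomial e' 1, ⟨?_, ?_⟩, ?_⟩, le_rfl⟩
    · change aeval (gen K a) _ = 0
      rw [map_sub, aeval_gen_monomial, aeval_gen_monomial, h1, sub_self]
    · intro h
      have := sub_eq_zero.1 (Set.mem_singleton_iff.1 h)
      rw [this] at hlt
      exact lt_irrefl _ hlt
    · rw [MonomialOrder.degree_sub_of_lt hlt, MonomialOrder.degree_monomial, if_neg one_ne_zero]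

theorem quadraticAt_iff {ρ : Equiv.Perm (Fin n)} {i : Fin n} :
    QuadraticAt K a ρ i ↔ ∀ e, Minimal (Nonstandard a ρ) e → 0 < e i → e.degree = 2 := by
  classical
  have h1 : ∀ e : Fin n →₀ ℕ, monomial e (1 : K) ∈ Ideal.span {(X i : MvPolynomial (Fin n) K)} ↔
      0 < e i := by
    intro e
    rw [Ideal.mem_span_singleton, X, monomial_dvd_monomial]
    simp [Nat.pos_iff_ne_zero, Nat.one_le_iff_ne_zero]
  have h2 : ∀ e : Fin n →₀ ℕ, (monomial e (1 : K)).totalDegree = e.degree := by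
    intro e
    rw [totalDegree_monomial _ one_ne_zero]
    rfl
  simp only [QuadraticAt, minimalGenerators, monomial_mem_initialIdeal_iff]
  constructor
  · intro h e he hi
    rw [← h2]
    exact h _ ⟨e, he, rfl⟩ ((h1 e).2 hi)
  · rintro h _ ⟨e, he, rfl⟩ hi
    rw [h2]
    exact h e he ((h1 e).1 hi)

/-- Homogeneity equates the degrees. As f involves only variables larger than x_k, the first
difference is at or before k and favours e. -/
theorem RevLex.lt_of_pos {ρ : Equiv.Perm (Fin n)} {δ : ℕ} (hδ : 0 < δ)
    (hdeg : ∀ i, (a i).degree = δ) {e f : Fin n →₀ ℕ} (h : expMap a e = expMap a f) {k : Fin n}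
    (hk : 0 < e k) (hf : ∀ l, ρ l ≤ ρ k → f l = 0) : (⟨e⟩ : RevLex ρ) < ⟨f⟩ := by
  have hd : e.degree = f.degree := by
    have := congrArg Finsupp.degree h
    rw [degree_expMap hdeg, degree_expMap hdeg] at this
    exact Nat.eq_of_mul_eq_mul_right hδ this
  by_contra hcon
  rcases (not_lt.1 hcon).eq_or_lt with heq | hlt
  · have := congrArg RevLex.exps heq
    simp only at this
    have h0 := hf k le_rfl
    rw [this] at h0
    omega
  · rw [RevLex.lt_iff] at hlt
    rcases hlt with hlt | ⟨-, k', h1, h2⟩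
    · simp only at hlt
      omega
    · simp only at h1 h2
      have hkk : ρ k < ρ k' := by
        by_contra hle
        have := hf k' (not_lt.1 hle)
        omega
      have := h1 k hkk
      have := hf k le_rfl
      omega

/-- For a minimal nonstandard monomial divisible by the second smallest variable `x_i`, some
monomial with the same image is divisible by the smallest variable `x_j`. -/
theorem exists_pos_of_minimal {ρ : Equiv.Perm (Fin n)} {δ : ℕ} (hδ : 0 < δ)
    (hdeg : ∀ i, (a i).degree = δ) {i j : Fin n} (hi : ∀ l, l ≠ i → l ≠ j → ρ i < ρ l)
    {e : Fin n →₀ ℕ} (he : Minimal (Nonstandard a ρ) e) (hpos : 0 < e i) :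
    e j = 0 ∧ ∃ e', expMap a e' = expMap a e ∧ 0 < e' j := by
  obtain ⟨e', hL, hlt⟩ := he.prop
  -- A common variable could be cancelled, leaving a proper nonstandard divisor of e.
  have hdis : ∀ k, e k = 0 ∨ e' k = 0 := by
    intro k
    by_contra! hcon
    obtain ⟨f, rfl⟩ := exists_single_add (Nat.pos_of_ne_zero hcon.1)
    obtain ⟨f', rfl⟩ := exists_single_add (Nat.pos_of_ne_zero hcon.2)
    rw [RevLex.add_lt_add_iff_left] at hlt
    rw [map_add, map_add] at hL
    have hle : f ≤ Finsupp.single k 1 + f := le_add_self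
    have := he.le_of_le ⟨f', add_left_cancel hL, hlt⟩ hle k
    simp at this
  have hd : e'.degree = e.degree := by
    have := congrArg Finsupp.degree hL
    rw [degree_expMap hdeg, degree_expMap hdeg] at this
    exact Nat.eq_of_mul_eq_mul_right hδ this
  rw [RevLex.lt_iff] at hlt
  rcases hlt with hlt | ⟨-, k, h1, h2⟩
  · simp only at hlt
    omega
  · simp only at h1 h2
    have hi0 : e' i = 0 := (hdis i).resolve_left hpos.ne'
    have hk0 : e k = 0 := (hdis k).resolve_right (by omega)
    have hki : k ≠ i := by
      rintro rfl
      omega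
    -- The first difference k satisfies e k < e' k. Beyond x_i it would require agreement at i,
    -- where e is positive and e' vanishes.
    have hkj : k = j := by
      by_contra hne
      have := h1 i (hi k hki hne)
      omega
    subst hkj
    exact ⟨hk0, e', hL, by omega⟩

theorem exists_eq_single_of_degree_eq_one {e : Fin n →₀ ℕ} (h : e.degree = 1) :
    ∃ k, e = Finsupp.single k 1 := by
  have h0 : e ≠ 0 := by
    rintro rfl
    simp at h
  obtain ⟨k, hk⟩ := Finsupp.ne_iff.1 h0
  obtain ⟨f, rfl⟩ := exists_single_add (Nat.pos_of_ne_zero hk)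
  refine ⟨k, ?_⟩
  simp only [map_add, Finsupp.degree_single] at h
  have : f = 0 := by rw [← Finsupp.degree_eq_zero_iff]; omega
  simp [this]

/-- Quadratic generators divisible by the second smallest variable give the exchange property for
the two smallest variables. -/
theorem exchange_of_quadratic {ρ : Equiv.Perm (Fin n)} {δ : ℕ} (hδ : 0 < δ)
    (hdeg : ∀ i, (a i).degree = δ) {p q : Fin n} (hpq : p ≠ q) (hp : ∀ l, l ≠ p → ρ p < ρ l)
    (hq : ∀ l, l ≠ q → l ≠ p → ρ q < ρ l)
    (h : ∀ e, Minimal (Nonstandard a ρ) e → 0 < e q → e.degree = 2) {w : Fin d →₀ ℕ}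
    (hw : w ∈ expMonoid a) (hs : MemShift a (a p) (w + a q)) :
    ∃ k l, MemShift a (a k) w ∧ a k + a q = a p + a l := by
  -- Represent w by its standard monomial x^α.
  obtain ⟨x, hx, hmin⟩ := wellFounded_lt.has_min {x : RevLex ρ | expMap a x.exps = w} (by
    obtain ⟨e, he⟩ := mem_expMonoid_iff.1 hw
    exact ⟨⟨e⟩, he⟩)
  obtain ⟨α⟩ := x
  have hx' : expMap a α = w := hx
  subst hx'
  have hstd : ¬ Nonstandard a ρ α := by
    rintro ⟨e', h1, h2⟩
    exact hmin ⟨e'⟩ h1 h2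
  rcases Nat.eq_zero_or_pos (α p) with h0 | hpos
  swap
  · exact ⟨p, q, memShift_expMap hpos, rfl⟩
  have hns : Nonstandard a ρ (Finsupp.single q 1 + α) := by
    obtain ⟨γ, hγ⟩ := memShift_iff_exists.1 hs
    have hL : expMap a (Finsupp.single p 1 + γ) = expMap a (Finsupp.single q 1 + α) := by
      rw [← hγ, map_add, expMap_single, add_comm]
    refine ⟨_, hL, RevLex.lt_of_pos hδ hdeg hL (k := p) (by simp) fun l hl => ?_⟩
    have : l = p := by
      by_contra hne
      exact absurd (hp l hne) (not_lt.2 hl)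
    subst this
    simp [h0, hpq]
  obtain ⟨g, hg, hmin⟩ := exists_minimal_le_of_wellFoundedLT (Nonstandard a ρ) _ hns
  -- Otherwise g would divide the standard monomial x^α.
  have hgq : 0 < g q := by
    by_contra hcon
    refine hstd (hmin.prop.mono fun l => ?_)
    by_cases hl : l = q
    · subst hl
      omega
    · have := hg l
      simpa [Finsupp.single_apply, Ne.symm hl] using this
  have hdeg2 := h g hmin hgq
  obtain ⟨-, g', hL, hgp⟩ := exists_pos_of_minimal hδ hdeg hq hmin hgq
  have hd : g'.degree = g.degree := by
    have := congrArg Finsupp.degree hL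
    rw [degree_expMap hdeg, degree_expMap hdeg] at this
    exact Nat.eq_of_mul_eq_mul_right hδ this
  obtain ⟨g₁, rfl⟩ := exists_single_add hgq
  obtain ⟨g₂, rfl⟩ := exists_single_add hgp
  obtain ⟨k, rfl⟩ := exists_eq_single_of_degree_eq_one (e := g₁) (by
    simp only [map_add, Finsupp.degree_single] at hdeg2
    omega)
  obtain ⟨l, rfl⟩ := exists_eq_single_of_degree_eq_one (e := g₂) (by
    rw [hdeg2] at hd
    simp only [map_add, Finsupp.degree_single] at hd
    omega)
  refine ⟨k, l, memShift_expMap ?_, ?_⟩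
  · have := (add_le_add_iff_left _).1 hg k
    rw [Finsupp.single_eq_same] at this
    omega
  · simp only [map_add, expMap_single] at hL
    rw [hL, add_comm]

theorem exchangeProperty_of_quadraticAt {n d δ : ℕ} {K : Type*} [Field K]
    {a : Fin n → Fin d →₀ ℕ} (hδ : 0 < δ) (hdeg : ∀ i, (a i).degree = δ)
    (h : ∀ i j : Fin n, i < j → ∃ (ρ : Equiv.Perm (Fin n)) (p q : Fin n),
      ({p, q} : Set (Fin n)) = {i, j} ∧ (ρ p : ℕ) = 0 ∧ (ρ q : ℕ) = 1 ∧ QuadraticAt K a ρ q) :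
    ExchangeProperty a := by
  have key : ∀ i j, i < j → ∀ w ∈ expMonoid a, MemShift a (a i) (w + a j) →
      ∃ k l, MemShift a (a k) w ∧ a k + a j = a i + a l := by
    intro i j hij
    obtain ⟨ρ, p, q, hset, hp, hq, hquad⟩ := h i j hij
    rw [quadraticAt_iff] at hquad
    have hpq : p ≠ q := by
      rintro rfl
      omega
    have hp' : ∀ l, l ≠ p → ρ p < ρ l := by
      intro l hl
      have : (ρ l : ℕ) ≠ ρ p := fun h => hl (ρ.injective (Fin.ext h))
      rw [Fin.lt_def]
      omega
    have hq' : ∀ l, l ≠ q → l ≠ p → ρ q < ρ l := by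
      intro l hl hl'
      have h1 : (ρ l : ℕ) ≠ ρ q := fun h => hl (ρ.injective (Fin.ext h))
      have h2 : (ρ l : ℕ) ≠ ρ p := fun h => hl' (ρ.injective (Fin.ext h))
      rw [Fin.lt_def]
      omega
    have hex : ∀ w ∈ expMonoid a, MemShift a (a p) (w + a q) →
        ∃ k l, MemShift a (a k) w ∧ a k + a q = a p + a l :=
      fun w hw hs => exchange_of_quadratic hδ hdeg hpq hp' hq' hquad hw hs
    rcases Set.pair_eq_pair_iff.1 hset with ⟨rfl, rfl⟩ | ⟨rfl, rfl⟩
    · exact hex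
    · exact exchange_symm hex
  intro i j hij
  rcases lt_or_gt_of_ne hij with h1 | h1
  · exact key i j h1
  · exact exchange_symm (key j i h1)

theorem mem_exchangeSet_iff {i j k : Fin n} :
    k ∈ exchangeSet K a i j ↔ k ≠ j ∧ MemShift a (a j) (a i + a k) := by
  refine and_congr Iff.rfl ?_
  constructor
  · rintro ⟨w, hw, e⟩
    have h1 := congrArg (coeff (a i + a k)) e
    rw [gen, gen, gen, monomial_mul, coeff_monomial_mul', coeff_monomial, if_pos rfl] at h1
    split_ifs at h1 with hle
    · refine ⟨a i + a k - a j, mem_toricRing_iff.1 hw _ ?_, (add_tsub_cancel_of_le hle).symm⟩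
      rw [mem_support_iff]
      intro h0
      simp [h0] at h1
    · simp at h1
  · rintro ⟨v, hv, e⟩
    exact ⟨monomial v 1, monomial_mem_toricRing hv 1, by simp [gen, monomial_mul, e]⟩

/-- The minimal generators divisible by `x_i` are quadratic for an exchange ordering. -/
theorem degree_eq_two_of_minimal {δ : ℕ} (hδ : 0 < δ) (hdeg : ∀ i, (a i).degree = δ)
    (hx : ExchangeProperty a) (hr : SquaresRigid a) {i j : Fin n} (hij : i ≠ j)
    {ρ : Equiv.Perm (Fin n)} (ho : IsExchangeOrdering K a i j ρ) {e : Fin n →₀ ℕ}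
    (he : Minimal (Nonstandard a ρ) e) (hpos : 0 < e i) : e.degree = 2 := by
  have hi : ∀ l, l ≠ i → l ≠ j → ρ i < ρ l := by
    intro l hl hl'
    by_cases hm : l ∈ exchangeSet K a i j
    exacts [ho.lt_exchange l hm, ho.lt_other l hl hl' hm]
  have hj : ∀ l, ρ l ≤ ρ j → l = j := by
    intro l hl
    by_contra hne
    by_cases hli : l = i
    · subst hli
      exact absurd ho.lt (not_lt.2 hl)
    · exact absurd (ho.lt.trans (hi l hli hne)) (not_lt.2 hl)
  obtain ⟨hj0, e', hL, hj'⟩ := exists_pos_of_minimal hδ hdeg hi he hpos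
  obtain ⟨α, rfl⟩ := exists_single_add hpos
  have hstd : ¬ Nonstandard a ρ α := by
    intro hns
    have := he.le_of_le hns le_add_self i
    simp at this
  have hαj : α j = 0 := by
    simp only [Finsupp.add_apply] at hj0
    omega
  -- A representation of u^α through the smallest variable x_j would be smaller than x^α.
  have hshift : ¬ MemShift a (a j) (expMap a α) := by
    intro hs
    obtain ⟨γ, hγ⟩ := memShift_iff_exists.1 hs
    refine hstd ⟨_, hγ.symm, RevLex.lt_of_pos hδ hdeg hγ.symm (k := j) (by simp) fun l hl => ?_⟩
    rw [hj l hl, hαj]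
  have hs : MemShift a (a j) (expMap a α + a i) := by
    have h1 := memShift_expMap (a := a) hj'
    rwa [hL, map_add, expMap_single, add_comm] at h1
  obtain ⟨k, l, hk, hkl⟩ := hx j i hij.symm _ (expMap_mem α) hs
  have hkj : k ≠ j := by
    rintro rfl
    exact hshift hk
  have hkE : k ∈ exchangeSet K a i j :=
    mem_exchangeSet_iff.2 ⟨hkj, a l, exp_mem a l, by rw [add_comm, hkl]⟩
  -- If x^α contains an exchange variable x_m, then u_i u_m ∈ (u_j) makes x_i x_m nonstandard, so it
  -- is the whole generator.
  by_cases hex : ∃ m ∈ exchangeSet K a i j, 0 < α m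
  · obtain ⟨m, hm, hαm⟩ := hex
    have hm' := mem_exchangeSet_iff.1 hm
    have hns : Nonstandard a ρ (Finsupp.single i 1 + Finsupp.single m 1) := by
      obtain ⟨γ, hγ⟩ := memShift_iff_exists.1 hm'.2
      have hL' : expMap a (Finsupp.single j 1 + γ) =
          expMap a (Finsupp.single i 1 + Finsupp.single m 1) := by
        rw [← hγ]
        simp
      refine ⟨_, hL', RevLex.lt_of_pos hδ hdeg hL' (k := j) (by simp) fun l hl => ?_⟩
      rw [hj l hl]
      simp [hij.symm, hm'.1.symm]
    have hle : Finsupp.single i 1 + Finsupp.single m 1 ≤ Finsupp.single i 1 + α := by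
      refine add_le_add_right ?_ _
      rw [Finsupp.single_le_iff]
      exact hαm
    rw [le_antisymm (he.le_of_le hns hle) hle]
    simp
  · push Not at hex
    have hex' : ∀ m ∈ exchangeSet K a i j, α m = 0 := fun m hm => Nat.le_zero.1 (hex m hm)
    exfalso
    rcases Nat.eq_zero_or_pos (α i) with hαi | hαi
    -- Now x^α involves only variables outside the exchange set, all larger than x_k.
    · obtain ⟨γ, hγ⟩ := memShift_iff_exists.1 hk
      refine hstd ⟨_, hγ.symm, RevLex.lt_of_pos hδ hdeg hγ.symm (k := k) (by simp) fun l hl => ?_⟩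
      by_cases h1 : l = i
      · rw [h1, hαi]
      by_cases h2 : l = j
      · rw [h2, hαj]
      by_cases h3 : l ∈ exchangeSet K a i j
      · exact hex' l h3
      · exact absurd (ho.exchange_lt_other k hkE l h1 h2 h3) (not_lt.2 hl)
    · obtain ⟨γ, rfl⟩ := exists_single_add hαi
      refine hshift ?_
      rw [map_add, expMap_single] at hs ⊢
      refine hx.memShift_of_double hr hδ hdeg (expMap_mem γ) ?_
      rwa [add_right_comm] at hs

theorem exists_isExchangeOrdering (hr : SquaresRigid a) {δ : ℕ} (hδ : 0 < δ)
    (hdeg : ∀ i, (a i).degree = δ) {i j : Fin n} (hij : i ≠ j) :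
    ∃ ρ : Equiv.Perm (Fin n), IsExchangeOrdering K a i j ρ ∧ (ρ j : ℕ) = 0 ∧ (ρ i : ℕ) = 1 := by
  classical
  -- Without rigidity u_i² / u_j could be a generator, and the required order would demand x_i <
  -- x_i.
  have hi : i ∉ exchangeSet K a i j := by
    intro h
    obtain ⟨-, v, hv, e⟩ := mem_exchangeSet_iff.1 h
    obtain ⟨l, rfl⟩ := exists_eq_of_degree_eq hδ hdeg hv (by
      have := congrArg Finsupp.degree e
      simp only [map_add, hdeg] at this
      omega)
    exact hij (hr i j l e).symm
  have hjE : j ∉ exchangeSet K a i j := fun h => h.1 rfl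
  let f : Fin n → ℕ := fun k =>
    if k = j then 0 else if k = i then 1 else if k ∈ exchangeSet K a i j then 2 else 3
  -- The sorting permutation sends positions to variables; its inverse gives the position of each
  -- variable.
  let ρ : Equiv.Perm (Fin n) := (Tuple.sort f).symm
  have hρ : ∀ k l, f k < f l → ρ k < ρ l := by
    intro k l hkl
    by_contra hcon
    have := Tuple.monotone_sort f (not_lt.1 hcon)
    simp only [Function.comp_apply, ρ, Equiv.apply_symm_apply] at this
    omega
  have hfj : f j = 0 := by simp [f]
  have hfi : f i = 1 := by simp [f, hij]
  have hfE : ∀ k ∈ exchangeSet K a i j, f k = 2 := by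
    intro k hk
    have h1 : k ≠ j := fun h => hjE (h ▸ hk)
    have h2 : k ≠ i := fun h => hi (h ▸ hk)
    simp [f, h1, h2, hk]
  have hfO : ∀ l, l ≠ i → l ≠ j → l ∉ exchangeSet K a i j → f l = 3 := by
    intro l h1 h2 h3
    simp [f, h1, h2, h3]
  have hord : IsExchangeOrdering K a i j ρ :=
    { lt := hρ _ _ (by omega)
      lt_exchange := fun k hk => hρ _ _ (by rw [hfi, hfE k hk]; omega)
      lt_other := fun l h1 h2 h3 => hρ _ _ (by rw [hfi, hfO l h1 h2 h3]; omega)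
      exchange_lt_other := fun k hk l h1 h2 h3 =>
        hρ _ _ (by rw [hfE k hk, hfO l h1 h2 h3]; omega) }
  have hji := hord.lt
  have hle : ∀ l, l ≠ j → l ≠ i → ρ i < ρ l := by
    intro l h1 h2
    by_cases h3 : l ∈ exchangeSet K a i j
    exacts [hord.lt_exchange l h3, hord.lt_other l h2 h1 h3]
  have hsurj : ∀ m : Fin n, m < ρ i → m = ρ j := by
    intro m hm
    obtain ⟨l, rfl⟩ := ρ.surjective m
    by_cases h1 : l = j
    · rw [h1]
    · by_cases h2 : l = i
      · rw [h2] at hm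
        exact absurd hm (lt_irrefl _)
      · exact absurd (hle l h1 h2) (not_lt.2 hm.le)
  refine ⟨ρ, hord, ?_⟩
  rw [Fin.lt_def] at hji
  have h0 := hsurj ⟨0, by omega⟩ (by rw [Fin.lt_def]; simp only; omega)
  have h0' : (ρ j : ℕ) = 0 := by rw [← h0]
  refine ⟨h0', ?_⟩
  by_contra hne
  have h1 := hsurj ⟨1, by omega⟩ (by rw [Fin.lt_def]; simp only; omega)
  rw [← h1] at h0'
  simp at h0'

end Standard

/-! ### Polynomials with squarefree monomials. -/

section MultiAffine

variable {σ K : Type*} [Field K]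

/-- Degrees in each variable add over a field, so a factor occurring twice has degree 0 in every
variable. -/
theorem squarefree_of_support_le_one {f : MvPolynomial σ K} (h0 : f ≠ 0)
    (hf : ∀ m ∈ f.support, ∀ s, m s ≤ 1) : Squarefree f := by
  rintro x ⟨y, rfl⟩
  have hxy : x * x ≠ 0 := left_ne_zero_of_mul h0
  have hy : y ≠ 0 := right_ne_zero_of_mul h0
  have hx : x ≠ 0 := left_ne_zero_of_mul hxy
  have hd : ∀ s, degreeOf s x = 0 := by
    intro s
    have h1 : degreeOf s (x * x * y) ≤ 1 := degreeOf_le_iff.2 fun m hm => hf m hm s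
    rw [degreeOf_mul_eq hxy hy, degreeOf_mul_eq hx hx] at h1
    omega
  have ht : x.totalDegree = 0 := by
    rw [totalDegree_eq_zero_iff]
    intro m hm s
    exact Nat.le_zero.1 (degreeOf_le_iff.1 (hd s).le m hm)
  rw [isUnit_iff_totalDegree_of_isReduced]
  refine ⟨?_, ht⟩
  rw [isUnit_iff_ne_zero]
  intro hc
  apply hx
  rw [totalDegree_eq_zero_iff_eq_C.1 ht, hc, C_0]

/-- Being squarefree, g divides f. Writing f = g r gives h = r² g, and squarefreeness of h makes r a
unit, hence a constant. -/
theorem exists_eq_C_mul_of_sq_eq_mul {f g h : MvPolynomial σ K} (hg0 : g ≠ 0) (hh0 : h ≠ 0)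
    (hg : ∀ m ∈ g.support, ∀ s, m s ≤ 1) (hh : ∀ m ∈ h.support, ∀ s, m s ≤ 1)
    (e : f * f = g * h) : ∃ c : K, f = C c * g := by
  have hdvd : g ∣ f := by
    have := squarefree_of_support_le_one hg0 hg
    exact (this.dvd_pow_iff_dvd two_ne_zero).1 ⟨h, by rw [pow_two, e]⟩
  obtain ⟨r, rfl⟩ := hdvd
  have e2 : h = r * r * g := by
    apply mul_left_cancel₀ hg0
    rw [← e]
    ring
  have hr : IsUnit r := squarefree_of_support_le_one hh0 hh r ⟨g, e2⟩
  obtain ⟨c, -, hc⟩ := isUnit_iff_eq_C_of_isReduced.1 hr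
  exact ⟨c, by rw [hc, mul_comm]⟩

end MultiAffine

/-! ### A dimension count. -/

section LinearAlgebra

variable {K E : Type*} [Field K] [AddCommGroup E] [Module K E]

/-- The chain dim V ≤ dim E/N ≤ dim D ≤ dim E/P ≤ dim V collapses to equalities, so the surjection V
→ E/P is injective. -/
theorem disjoint_of_disjoint_of_sup_eq_top {V N D P : Submodule K E} [FiniteDimensional K V]
    (hVN : Disjoint V N) (hDN : D ⊔ N = ⊤) (hDP : Disjoint D P) (hVP : V ⊔ P = ⊤) :
    Disjoint V P := by
  have inj : ∀ {U W : Submodule K E}, Disjoint U W ↔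
      Function.Injective (W.mkQ ∘ₗ U.subtype) := by
    intro U W
    rw [← LinearMap.ker_eq_bot, LinearMap.ker_comp, Submodule.ker_mkQ,
      Submodule.disjoint_iff_comap_eq_bot]
  have surj : ∀ {U W : Submodule K E}, U ⊔ W = ⊤ →
      Function.Surjective (W.mkQ ∘ₗ U.subtype) := by
    intro U W h y
    obtain ⟨x, rfl⟩ := W.mkQ_surjective y
    have hx : x ∈ U ⊔ W := h ▸ Submodule.mem_top
    obtain ⟨u, hu, w, hw, rfl⟩ := Submodule.mem_sup.1 hx
    refine ⟨⟨u, hu⟩, ?_⟩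
    simpa using hw
  have fP : FiniteDimensional K (E ⧸ P) := Module.Finite.of_surjective _ (surj hVP)
  have fD : FiniteDimensional K D := Module.Finite.of_injective _ (inj.1 hDP)
  have fN : FiniteDimensional K (E ⧸ N) := Module.Finite.of_surjective _ (surj hDN)
  have h1 := LinearMap.finrank_le_finrank_of_injective (inj.1 hVN)
  have h2 := LinearMap.finrank_le_finrank_of_surjective (surj hDN)
  have h3 := LinearMap.finrank_le_finrank_of_injective (inj.1 hDP)
  have h4 := LinearMap.finrank_le_finrank_of_surjective (surj hVP)
  rw [inj, LinearMap.injective_iff_surjective_of_finrank_eq_finrank (by omega)]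
  exact surj hVP

end LinearAlgebra

/-! ### Taylor expansion at a point. -/

section PolynomialsInGenerators

variable {n : ℕ} {K R : Type*} [Field K] [CommRing R] [Algebra K R]

/-- The polynomial expressions of degree at most `k` in the elements `v i`. -/
noncomputable def polyLE (v : Fin n → R) (k : ℕ) : Submodule K R :=
  (restrictTotalDegree (Fin n) K k).map (aeval v).toLinearMap

instance (v : Fin n → R) (k : ℕ) : FiniteDimensional K (polyLE (K := K) v k) :=
  Module.Finite.map _ _

theorem mem_polyLE_iff {v : Fin n → R} {k : ℕ} {x : R} :
    x ∈ polyLE (K := K) v k ↔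
      ∃ F : MvPolynomial (Fin n) K, F.totalDegree ≤ k ∧ aeval v F = x := by
  simp only [polyLE, Submodule.mem_map, mem_restrictTotalDegree]
  rfl

theorem gen_mem_polyLE (v : Fin n → R) (i : Fin n) : v i ∈ polyLE (K := K) v 1 :=
  mem_polyLE_iff.2 ⟨X i, (totalDegree_X i).le, aeval_X v i⟩

theorem algebraMap_mem_polyLE (v : Fin n → R) (k : ℕ) (c : K) :
    algebraMap K R c ∈ polyLE (K := K) v k :=
  mem_polyLE_iff.2 ⟨C c, by simp, by simp⟩

theorem mul_mem_polyLE {v : Fin n → R} {k l : ℕ} {x y : R} (hx : x ∈ polyLE (K := K) v k)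
    (hy : y ∈ polyLE (K := K) v l) : x * y ∈ polyLE (K := K) v (k + l) := by
  obtain ⟨F, hF, rfl⟩ := mem_polyLE_iff.1 hx
  obtain ⟨G, hG, rfl⟩ := mem_polyLE_iff.1 hy
  exact mem_polyLE_iff.2 ⟨F * G, (totalDegree_mul F G).trans (add_le_add hF hG), map_mul _ _ _⟩

/-- Expand in the translates v_i - ε(v_i): terms of degree at most k are polynomials in v of that
degree, and the others lie in the power of the kernel. -/
theorem polyLE_sup_ker_pow {v : Fin n → R} (hv : Algebra.adjoin K (Set.range v) = ⊤)
    (ε : R →ₐ[K] K) (k : ℕ) :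
    polyLE v k ⊔ ((RingHom.ker ε) ^ (k + 1)).restrictScalars K = ⊤ := by
  set g : Fin n → R := fun i => v i - algebraMap K R (ε (v i)) with hg
  have hgker : ∀ i, g i ∈ RingHom.ker ε := fun i => by
    simp [RingHom.mem_ker, hg]
  have hsurj : Algebra.adjoin K (Set.range g) = ⊤ := by
    rw [eq_top_iff, ← hv, Algebra.adjoin_le_iff]
    rintro _ ⟨i, rfl⟩
    have : v i = g i + algebraMap K R (ε (v i)) := by simp [hg]
    rw [SetLike.mem_coe, this]
    exact add_mem (Algebra.subset_adjoin ⟨i, rfl⟩) (Subalgebra.algebraMap_mem _ _)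
  have hpow : ∀ e : Fin n →₀ ℕ, (e.prod fun i m => g i ^ m) ∈ (RingHom.ker ε) ^ e.degree := by
    intro e
    induction e using Finsupp.induction_linear with
    | zero => simp
    | add f h hf hh =>
      rw [Finsupp.prod_add_index' (by simp) (by intros; rw [pow_add]), map_add, pow_add]
      exact Ideal.mul_mem_mul hf hh
    | single i c => simpa using Ideal.pow_mem_pow (hgker i) c
  have hlow : ∀ e : Fin n →₀ ℕ, (e.prod fun i m => g i ^ m) ∈ polyLE (K := K) v e.degree := by
    intro e
    induction e using Finsupp.induction_linear with
    | zero => simpa using algebraMap_mem_polyLE (K := K) v 0 1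
    | add f h hf hh =>
      rw [Finsupp.prod_add_index' (by simp) (by intros; rw [pow_add]), map_add]
      exact mul_mem_polyLE hf hh
    | single i c =>
      simp only [pow_zero, Finsupp.prod_single_index, Finsupp.degree_single]
      induction c with
      | zero => simpa using algebraMap_mem_polyLE (K := K) v 0 1
      | succ c ih =>
        rw [pow_succ]
        exact mul_mem_polyLE ih (sub_mem (gen_mem_polyLE v i) (algebraMap_mem_polyLE v 1 _))
  have hmono : ∀ l ≤ k, polyLE (K := K) v l ≤ polyLE v k := by
    intro l hl x hx
    obtain ⟨F, hF, rfl⟩ := mem_polyLE_iff.1 hx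
    exact mem_polyLE_iff.2 ⟨F, hF.trans hl, rfl⟩
  rw [eq_top_iff]
  intro x _
  have hx : x ∈ Algebra.adjoin K (Set.range g) := hsurj ▸ Algebra.mem_top
  rw [Algebra.adjoin_range_eq_range_aeval] at hx
  obtain ⟨F, rfl⟩ := hx
  change aeval g F ∈ _
  rw [F.as_sum, map_sum]
  refine sum_mem fun e _ => ?_
  rw [aeval_monomial, ← Algebra.smul_def]
  refine Submodule.smul_mem _ _ ?_
  rcases le_or_gt e.degree k with h | h
  · exact Submodule.mem_sup_left (hmono _ h (hlow e))
  · exact Submodule.mem_sup_right (Ideal.pow_le_pow_right h (hpow e))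

end PolynomialsInGenerators

/-! ### Powers of the graded maximal ideal and of other points. -/

section PowersOfMaximalIdeal

variable {n d : ℕ} {K : Type*} [Field K] {a : Fin n → Fin d →₀ ℕ}

/-- The sums of `k` nonzero elements and one arbitrary element of the affine monoid. -/
def powExps (a : Fin n → Fin d →₀ ℕ) : ℕ → Set (Fin d →₀ ℕ)
  | 0 => expMonoid a
  | k + 1 => {m | ∃ x ∈ expMonoid a, x ≠ 0 ∧ ∃ y ∈ powExps a k, m = x + y}

theorem powExps_subset {k : ℕ} {m : Fin d →₀ ℕ} (hm : m ∈ powExps a k) : m ∈ expMonoid a := by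
  induction k generalizing m with
  | zero => exact hm
  | succ k ih =>
    obtain ⟨y, hy, -, z, hz, rfl⟩ := hm
    exact add_mem hy (ih hz)

theorem mem_powExps_one {m : Fin d →₀ ℕ} (hm : m ∈ expMonoid a) (h0 : m ≠ 0) :
    m ∈ powExps a 1 :=
  ⟨m, hm, h0, 0, zero_mem (expMonoid a), (add_zero m).symm⟩

theorem mem_gradedMaximalIdeal_iff {f : toricRing K a} :
    f ∈ gradedMaximalIdeal K a ↔ coeff 0 f.1 = 0 := Iff.rfl

theorem toricMonomial_mem_gradedMaximalIdeal {m : Fin d →₀ ℕ} (hm : m ∈ expMonoid a)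
    (h0 : m ≠ 0) : toricMonomial K hm ∈ gradedMaximalIdeal K a := by
  classical
  rw [mem_gradedMaximalIdeal_iff, coe_toricMonomial, coeff_monomial, if_neg h0]

theorem mem_gradedMaximalIdeal_pow_iff {k : ℕ} {f : toricRing K a} :
    f ∈ gradedMaximalIdeal K a ^ k ↔ ∀ m ∈ f.1.support, m ∈ powExps a k := by
  classical
  constructor
  · induction k generalizing f with
    | zero => exact fun _ => mem_toricRing_iff.1 f.2
    | succ k ih =>
      intro hf
      rw [pow_succ'] at hf
      refine Submodule.mul_induction_on hf (fun x hx y hy m hm => ?_) fun x y hx hy m hm => ?_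
      · have hm' := support_mul x.1 y.1 hm
        obtain ⟨p, hp, q, hq, rfl⟩ := Finset.mem_add.1 hm'
        refine ⟨p, mem_toricRing_iff.1 x.2 p hp, ?_, q, ih hy q hq, rfl⟩
        rintro rfl
        exact mem_support_iff.1 hp (mem_gradedMaximalIdeal_iff.1 hx)
      · rcases Finset.mem_union.1 (support_add hm) with h | h
        exacts [hx m h, hy m h]
  · intro h
    refine mem_ideal_of_toricMonomial_mem fun m hm hmf => ?_
    have hmk := h m hmf
    clear h hmf
    induction k generalizing m with
    | zero => simp
    | succ k ih =>
      obtain ⟨x, hx, hx0, y, hy, rfl⟩ := hmk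
      rw [toricMonomial_add hx (powExps_subset hy), pow_succ']
      exact Ideal.mul_mem_mul (toricMonomial_mem_gradedMaximalIdeal hx hx0)
        (ih y (powExps_subset hy) hy)

theorem toricMonomial_mem_pow_iff {k : ℕ} {m : Fin d →₀ ℕ} (hm : m ∈ expMonoid a) :
    toricMonomial K hm ∈ gradedMaximalIdeal K a ^ k ↔ m ∈ powExps a k := by
  rw [mem_gradedMaximalIdeal_pow_iff, support_toricMonomial]
  simp

/-- An irreducible element of the affine monoid is one of the generators. -/
theorem exists_eq_of_notMem_powExps_two {m : Fin d →₀ ℕ} (hm : m ∈ expMonoid a) (h0 : m ≠ 0)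
    (h2 : m ∉ powExps a 2) : ∃ j, m = a j := by
  induction hm using AddSubmonoid.closure_induction_left with
  | zero => exact absurd rfl h0
  | add_left x hx y hy ih =>
    obtain ⟨j, rfl⟩ := hx
    by_cases hy0 : y = 0
    · exact ⟨j, by simp [hy0]⟩
    -- The generators are not assumed homogeneous here, so one may be the monomial 1.
    by_cases hj0 : a j = 0
    · rw [hj0, zero_add] at h2 ⊢
      exact ih hy0 h2
    · exact absurd ⟨a j, exp_mem a j, hj0, y, mem_powExps_one hy hy0, rfl⟩ h2

/-- The span of the monomials outside of the `k`-th power of the graded maximal ideal. -/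
def standardSpan (K : Type*) [Field K] (a : Fin n → Fin d →₀ ℕ) (k : ℕ) :
    Submodule K (toricRing K a) where
  carrier := {f | ∀ m ∈ f.1.support, m ∉ powExps a k}
  zero_mem' := by simp
  add_mem' := by
    classical
    intro x y hx hy m hm
    rcases Finset.mem_union.1 (support_add hm) with h | h
    exacts [hx m h, hy m h]
  smul_mem' := by
    intro c x hx m hm
    exact hx m (support_smul hm)

theorem mem_standardSpan_iff {k : ℕ} {f : toricRing K a} :
    f ∈ standardSpan K a k ↔ ∀ m ∈ f.1.support, m ∉ powExps a k := Iff.rfl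

theorem disjoint_standardSpan (k : ℕ) :
    Disjoint (standardSpan K a k) ((gradedMaximalIdeal K a ^ k).restrictScalars K) := by
  rw [Submodule.disjoint_def]
  intro f hf hf'
  apply Subtype.ext
  change f.1 = 0
  rw [← support_eq_empty, Finset.eq_empty_iff_forall_notMem]
  intro m hm
  exact hf m hm (mem_gradedMaximalIdeal_pow_iff.1 hf' m hm)

/-- Replace k nontrivial factors u of the monomial by u - χ(u): this changes only terms of lower
degree. -/
theorem exists_mem_ker_pow_degree_lt (χ : toricRing K a →ₐ[K] K) {k : ℕ} {m : Fin d →₀ ℕ}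
    (hm : m ∈ expMonoid a) (hmk : m ∈ powExps a k) :
    ∃ g ∈ RingHom.ker χ ^ k,
      ∀ m' ∈ (toricMonomial K hm - g).1.support, m'.degree < m.degree := by
  classical
  induction k generalizing m with
  | zero => exact ⟨toricMonomial K hm, by simp, by simp⟩
  | succ k ih =>
    obtain ⟨x, hx, hx0, y, hy, rfl⟩ := hmk
    have hy' := powExps_subset hy
    obtain ⟨g, hg, hlt⟩ := ih hy' hy
    have hxd : 0 < x.degree := by
      rw [Nat.pos_iff_ne_zero, Ne, Finsupp.degree_eq_zero_iff]
      exact hx0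
    have hgle : ∀ m' ∈ g.1.support, m'.degree ≤ y.degree := by
      intro m' hm'
      have e : g.1 = monomial y 1 - (toricMonomial K hy' - g).1 := by simp
      rw [e] at hm'
      rcases Finset.mem_union.1 (support_sub _ _ _ hm') with h | h
      · rw [Finset.mem_singleton.1 (support_monomial_subset h)]
      · exact (hlt m' h).le
    refine ⟨(toricMonomial K hx - algebraMap K _ (χ (toricMonomial K hx))) * g, ?_, ?_⟩
    · rw [pow_succ']
      exact Ideal.mul_mem_mul (by simp [RingHom.mem_ker]) hg
    · intro m' hm'
      have e : toricMonomial K hm -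
          (toricMonomial K hx - algebraMap K _ (χ (toricMonomial K hx))) * g =
          toricMonomial K hx * (toricMonomial K hy' - g) + χ (toricMonomial K hx) • g := by
        rw [toricMonomial_add hx hy', Algebra.smul_def]
        ring
      rw [e] at hm'
      rcases Finset.mem_union.1 (support_add hm') with h | h
      · obtain ⟨p, hp, q, hq, rfl⟩ := Finset.mem_add.1 (support_mul _ _ h)
        rw [support_toricMonomial, Finset.mem_singleton] at hp
        subst hp
        rw [map_add, map_add]
        have := hlt q hq
        omega
      · have := hgle m' (support_smul h)
        rw [map_add]
        omega

/-- By induction on degree, a monomial in the k-th power is traded modulo the power of the kernel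
for smaller ones. Thus no point has larger colength than the origin. -/
theorem standardSpan_sup_ker_pow (χ : toricRing K a →ₐ[K] K) (k : ℕ) :
    standardSpan K a k ⊔ (RingHom.ker χ ^ k).restrictScalars K = ⊤ := by
  set W := standardSpan K a k ⊔ (RingHom.ker χ ^ k).restrictScalars K with hW
  have key : ∀ N : ℕ, ∀ m (hm : m ∈ expMonoid a), m.degree < N → toricMonomial K hm ∈ W := by
    intro N
    induction N with
    | zero => intro m _ h; omega
    | succ N ih =>
      intro m hm hN
      by_cases hmk : m ∈ powExps a k
      · obtain ⟨g, hg, hlt⟩ := exists_mem_ker_pow_degree_lt χ hm hmk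
        have e : toricMonomial K hm = (toricMonomial K hm - g) + g := by ring
        rw [e]
        refine add_mem ?_ (Submodule.mem_sup_right hg)
        refine mem_of_toricMonomial_mem fun m' hm' hs => ih m' hm' ?_
        have := hlt m' hs
        omega
      · refine Submodule.mem_sup_left ?_
        rw [mem_standardSpan_iff, support_toricMonomial]
        simpa using hmk
  rw [eq_top_iff]
  exact fun f _ => mem_of_toricMonomial_mem fun m hm _ => key _ m hm (Nat.lt_succ_self _)

/-- The augmentation of the toric ring, with kernel the graded maximal ideal. -/
noncomputable def augmentation (K : Type*) [Field K] (a : Fin n → Fin d →₀ ℕ) :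
    toricRing K a →ₐ[K] K :=
  (aeval (fun _ => (0 : K))).comp (toricRing K a).val

theorem ker_augmentation : RingHom.ker (augmentation K a) = gradedMaximalIdeal K a := by
  ext f
  rw [RingHom.mem_ker, mem_gradedMaximalIdeal_iff]
  change aeval (fun _ => (0 : K)) f.1 = 0 ↔ _
  rw [aeval_zero', constantCoeff_eq]
  simp

theorem coe_aeval_toricGen (F : MvPolynomial (Fin n) K) :
    (aeval (toricGen K a) F : toricRing K a).1 = aeval (gen K a) F := by
  change (toricRing K a).val (aeval (toricGen K a) F) = _
  rw [← AlgHom.comp_apply, comp_aeval]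
  rfl

theorem adjoin_toricGen : Algebra.adjoin K (Set.range (toricGen K a)) = ⊤ := by
  rw [eq_top_iff]
  rintro ⟨f, hf⟩ -
  rw [Algebra.adjoin_range_eq_range_aeval]
  have hf' := hf
  rw [toricRing, Algebra.adjoin_range_eq_range_aeval] at hf'
  obtain ⟨F, hF⟩ := hf'
  exact ⟨F, Subtype.ext ((coe_aeval_toricGen F).trans hF)⟩

theorem mul_le_degree_of_mem_powExps {δ : ℕ} (hdeg : ∀ i, (a i).degree = δ) {k : ℕ}
    {m : Fin d →₀ ℕ} (hm : m ∈ powExps a k) : k * δ ≤ m.degree := by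
  induction k generalizing m with
  | zero => simp
  | succ k ih =>
    obtain ⟨x, hx, hx0, y, hy, rfl⟩ := hm
    have h1 := ih hy
    rcases eq_zero_or_memShift hx with rfl | ⟨i, v, -, rfl⟩
    · exact absurd rfl hx0
    · rw [map_add, map_add, hdeg, add_mul, one_mul]
      omega

/-- The monomials of x have degree at most kδ on one side and at least (k + 1)δ on the other. -/
theorem disjoint_polyLE_toricGen {δ : ℕ} (hδ : 0 < δ) (hdeg : ∀ i, (a i).degree = δ) {k : ℕ}
    {x : toricRing K a} (hx : x ∈ polyLE (K := K) (toricGen K a) k)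
    (hx' : x ∈ gradedMaximalIdeal K a ^ (k + 1)) : x = 0 := by
  classical
  obtain ⟨F, hF, rfl⟩ := mem_polyLE_iff.1 hx
  apply Subtype.ext
  change (aeval (toricGen K a) F : toricRing K a).1 = 0
  rw [← support_eq_empty, Finset.eq_empty_iff_forall_notMem]
  intro m hm
  have h1 := mul_le_degree_of_mem_powExps hdeg (mem_gradedMaximalIdeal_pow_iff.1 hx' m hm)
  rw [coe_aeval_toricGen, F.as_sum, map_sum] at hm
  obtain ⟨e, he, hme⟩ := Finset.mem_biUnion.1 (support_sum hm)
  rw [aeval_gen_monomial] at hme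
  rw [Finset.mem_singleton.1 (support_monomial_subset hme), degree_expMap hdeg] at h1
  have h2 : e.degree ≤ k := (le_totalDegree he).trans hF
  have := Nat.le_of_mul_le_mul_right h1 hδ
  omega

end PowersOfMaximalIdeal

/-! ### Linear parts and translated relations. -/

section Truncation

variable {n : ℕ} {K R : Type*} [Field K] [CommRing R] [Algebra K R]

theorem mul_sub_mul_mem_cube {𝔪 : Ideal R} {x x₁ y y₁ : R} (hx : x ∈ 𝔪) (hxx : x - x₁ ∈ 𝔪 ^ 2)
    (hy : y₁ ∈ 𝔪) (hyy : y - y₁ ∈ 𝔪 ^ 2) : x * y - x₁ * y₁ ∈ 𝔪 ^ 3 := by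
  have h1 : x * y - x₁ * y₁ = x * (y - y₁) + (x - x₁) * y₁ := by ring
  rw [h1]
  refine add_mem ?_ ?_
  · rw [pow_succ' 𝔪 2]
    exact Ideal.mul_mem_mul hx hyy
  · rw [pow_succ 𝔪 2]
    exact Ideal.mul_mem_mul hxx hy

/-- Replacing y and z by representatives in `polyLE v 1` changes the product only by an element of
𝔪³. The new product lies in `polyLE v 2` as well, so it is 0, and R is a domain. -/
theorem mem_sq_or_mem_sq_of_mul_mem_cube [IsDomain R] {v : Fin n → R} {𝔪 : Ideal R}
    (hsup : polyLE v 1 ⊔ (𝔪 ^ 2).restrictScalars K = ⊤)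
    (hdisj : Disjoint (polyLE v 2) ((𝔪 ^ 3).restrictScalars K)) {y z : R} (hy : y ∈ 𝔪)
    (hz : z ∈ 𝔪) (hyz : y * z ∈ 𝔪 ^ 3) : y ∈ 𝔪 ^ 2 ∨ z ∈ 𝔪 ^ 2 := by
  have hsplit : ∀ y ∈ 𝔪, ∃ y₁ ∈ polyLE (K := K) v 1, y₁ ∈ 𝔪 ∧ y - y₁ ∈ 𝔪 ^ 2 := by
    intro y hy
    have hy' : y ∈ polyLE (K := K) v 1 ⊔ (𝔪 ^ 2).restrictScalars K :=
      hsup ▸ Submodule.mem_top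
    obtain ⟨y₁, h1, y', h2, rfl⟩ := Submodule.mem_sup.1 hy'
    have h2' : y' ∈ 𝔪 := Ideal.pow_le_self two_ne_zero h2
    refine ⟨y₁, h1, ?_, ?_⟩
    · have := sub_mem hy h2'
      rwa [add_sub_cancel_right] at this
    · rw [add_sub_cancel_left]
      exact h2
  obtain ⟨y₁, hy1, hy2, hy3⟩ := hsplit y hy
  obtain ⟨z₁, hz1, hz2, hz3⟩ := hsplit z hz
  have hV : y₁ * z₁ ∈ polyLE (K := K) v (1 + 1) := mul_mem_polyLE hy1 hz1
  rw [one_add_one_eq_two] at hV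
  have h0 : y₁ * z₁ = 0 := by
    refine Submodule.disjoint_def.1 hdisj _ hV ?_
    have h3 : y₁ * z₁ = y * z - (y * z - y₁ * z₁) := by ring
    rw [h3]
    exact sub_mem hyz (mul_sub_mul_mem_cube hy hy3 hz2 hz3)
  rcases mul_eq_zero.1 h0 with rfl | rfl
  · exact Or.inl (by rwa [sub_zero] at hy3)
  · exact Or.inr (by rwa [sub_zero] at hz3)

/-- The translates `v i - ε (v i)` of the generators into the kernel of `ε`. -/
noncomputable def translate (ε : R →ₐ[K] K) (v : Fin n → R) (i : Fin n) : R :=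
  v i - algebraMap K R (ε (v i))

theorem translate_mem_ker (ε : R →ₐ[K] K) (v : Fin n → R) (i : Fin n) :
    translate ε v i ∈ RingHom.ker ε := by
  simp [RingHom.mem_ker, translate]

theorem translate_mem_polyLE (ε : R →ₐ[K] K) (v : Fin n → R) (i : Fin n) :
    translate ε v i ∈ polyLE (K := K) v 1 :=
  sub_mem (gen_mem_polyLE v i) (algebraMap_mem_polyLE v 1 _)

/-- The quadratic parts cancel by h, so the difference is a polynomial of degree at most 1 in v that
lies in the square of the kernel. -/
theorem translate_mul_self_eq {ε : R →ₐ[K] K} {v : Fin n → R}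
    (hdisj : Disjoint (polyLE v 1) ((RingHom.ker ε ^ 2).restrictScalars K)) {i k l : Fin n}
    (h : v i * v i = v k * v l) :
    translate ε v i * translate ε v i = translate ε v k * translate ε v l := by
  rw [← sub_eq_zero]
  refine Submodule.disjoint_def.1 hdisj _ ?_ ?_
  · have h1 : translate ε v i * translate ε v i - translate ε v k * translate ε v l =
        ε (v k) • v l + ε (v l) • v k - (2 * ε (v i)) • v i +
          algebraMap K R (ε (v i) * ε (v i) - ε (v k) * ε (v l)) := by
      simp only [translate, Algebra.smul_def, map_sub, map_mul, map_ofNat]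
      linear_combination h
    rw [h1]
    exact add_mem (sub_mem (add_mem (Submodule.smul_mem _ _ (gen_mem_polyLE v l))
      (Submodule.smul_mem _ _ (gen_mem_polyLE v k)))
      (Submodule.smul_mem _ _ (gen_mem_polyLE v i))) (algebraMap_mem_polyLE v 1 _)
  · have hm := translate_mem_ker ε v
    rw [pow_two]
    exact sub_mem (Ideal.mul_mem_mul (hm i) (hm i)) (Ideal.mul_mem_mul (hm k) (hm l))

end Truncation

/-! ### Squarefree toric rings have rigid squares. -/

section Rigidity

variable {n d N e : ℕ} {K : Type*} [Field K] {a : Fin n → Fin d →₀ ℕ} {b : Fin N → Fin e →₀ ℕ}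

theorem polyLE_map_sup_pow (φ : toricRing K a ≃ₐ[K] toricRing K b) (k : ℕ) :
    polyLE (fun i => φ (toricGen K a i)) k ⊔
      (gradedMaximalIdeal K b ^ (k + 1)).restrictScalars K = ⊤ := by
  rw [← ker_augmentation]
  refine polyLE_sup_ker_pow ?_ (augmentation K b) k
  have h1 : (Set.range fun i => φ (toricGen K a i)) =
      φ.toAlgHom '' Set.range (toricGen K a) := by
    rw [← Set.range_comp]
    rfl
  rw [h1, ← AlgHom.map_adjoin, adjoin_toricGen, Algebra.map_top, AlgHom.range_eq_top]
  exact φ.surjective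

/-- Under any isomorphism of `K[A]` with a toric ring, the generators of `K[A]` satisfy no
polynomial relation of degree at most `k` modulo the `(k + 1)`-st power of the graded maximal
ideal of that ring, other than those they satisfy outright. -/
theorem disjoint_polyLE_map {δ : ℕ} (hδ : 0 < δ) (hdeg : ∀ i, (a i).degree = δ)
    (φ : toricRing K a ≃ₐ[K] toricRing K b) (k : ℕ) :
    Disjoint (polyLE (K := K) (fun i => φ (toricGen K a i)) k)
      ((gradedMaximalIdeal K b ^ (k + 1)).restrictScalars K) := by
  set χ : toricRing K b →ₐ[K] K := (augmentation K a).comp φ.symm.toAlgHom with hχ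
  -- The two points compared are the origin of K[A], transported as χ, and the origin of K[B].
  refine disjoint_of_disjoint_of_sup_eq_top (N := (RingHom.ker χ ^ (k + 1)).restrictScalars K) ?_
    (standardSpan_sup_ker_pow χ (k + 1)) (disjoint_standardSpan (k + 1)) ?_
  · rw [Submodule.disjoint_def]
    intro x hx hx'
    have h1 : φ.symm x ∈ polyLE (K := K) (toricGen K a) k := by
      obtain ⟨F, hF, rfl⟩ := mem_polyLE_iff.1 hx
      refine mem_polyLE_iff.2 ⟨F, hF, ?_⟩
      apply φ.injective
      rw [AlgEquiv.apply_symm_apply]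
      exact (comp_aeval_apply (toricGen K a) φ.toAlgHom F)
    have h2 : φ.symm x ∈ gradedMaximalIdeal K a ^ (k + 1) := by
      have h3 := Ideal.mem_map_of_mem φ.symm.toRingHom hx'
      rw [Ideal.map_pow] at h3
      refine Ideal.pow_right_mono (Ideal.map_le_iff_le_comap.2 fun y hy => ?_) _ h3
      rw [← ker_augmentation]
      exact hy
    have h4 := disjoint_polyLE_toricGen hδ hdeg h1 h2
    simpa using h4
  · exact polyLE_map_sup_pow φ k

/-- Distinct translated generators are linearly independent modulo the square of the graded
maximal ideal. -/
theorem translate_sub_smul_notMem_sq {δ : ℕ} (hδ : 0 < δ) (ha : Function.Injective a)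
    (hdeg : ∀ i, (a i).degree = δ) (φ : toricRing K a ≃ₐ[K] toricRing K b) {x y : Fin n}
    (hxy : x ≠ y) (c : K) :
    translate (augmentation K b) (fun i => φ (toricGen K a i)) x -
      c • translate (augmentation K b) (fun i => φ (toricGen K a i)) y ∉
        gradedMaximalIdeal K b ^ 2 := by
  classical
  intro hmem
  have h0 := Submodule.disjoint_def.1 (disjoint_polyLE_map hδ hdeg φ 1) _
    (sub_mem (translate_mem_polyLE _ _ x) (Submodule.smul_mem _ c (translate_mem_polyLE _ _ y)))
    hmem
  have h1 : φ (toricGen K a x - c • toricGen K a y) = φ (algebraMap K _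
      (augmentation K b (φ (toricGen K a x)) - c * augmentation K b (φ (toricGen K a y)))) := by
    rw [map_sub, map_smul, AlgEquiv.commutes, map_sub, map_mul, ← sub_eq_zero, ← h0]
    simp only [translate, Algebra.smul_def]
    ring
  have h2 := congrArg (fun z : toricRing K a => coeff (a x) z.1) (φ.injective h1)
  have h3 : a y ≠ a x := fun h => hxy (ha h).symm
  have h4 : (0 : Fin d →₀ ℕ) ≠ a x := by
    intro h
    have := hdeg x
    rw [← h, map_zero] at this
    omega
  have h5 : ∀ c : K, coeff (a x) (algebraMap K (toricRing K a) c).1 = 0 := by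
    intro c
    change coeff (a x) (C c) = 0
    rw [coeff_C, if_neg h4]
  have h6 : coeff (a x) (toricGen K a x - c • toricGen K a y).1 = 1 := by
    change coeff (a x) (monomial (a x) (1 : K) - c • monomial (a y) (1 : K)) = 1
    rw [coeff_sub, coeff_smul, coeff_monomial, coeff_monomial, if_pos rfl, if_neg h3]
    simp
  simp only [h5, h6] at h2
  exact one_ne_zero h2

/-- K[B] need not be graded with generators in degree 1; the comparison with K[A] is what keeps
products of two irreducibles out of the cube. -/
theorem add_notMem_powExps_three {δ : ℕ} (hδ : 0 < δ) (hdeg : ∀ i, (a i).degree = δ)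
    (φ : toricRing K a ≃ₐ[K] toricRing K b) {x y : Fin e →₀ ℕ}
    (hx : x ∈ expMonoid b ∧ x ≠ 0 ∧ x ∉ powExps b 2)
    (hy : y ∈ expMonoid b ∧ y ≠ 0 ∧ y ∉ powExps b 2) : x + y ∉ powExps b 3 := by
  intro hxy
  rw [← toricMonomial_mem_pow_iff (K := K) (add_mem hx.1 hy.1), toricMonomial_add hx.1 hy.1] at hxy
  rcases mem_sq_or_mem_sq_of_mul_mem_cube (polyLE_map_sup_pow φ 1)
    (disjoint_polyLE_map hδ hdeg φ 2) (toricMonomial_mem_gradedMaximalIdeal hx.1 hx.2.1)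
    (toricMonomial_mem_gradedMaximalIdeal hy.1 hy.2.1) hxy with h | h
  · exact hx.2.2 ((toricMonomial_mem_pow_iff hx.1).1 h)
  · exact hy.2.2 ((toricMonomial_mem_pow_iff hy.1).1 h)

/-- Every element of the graded maximal ideal has a linear part, supported on irreducible
elements of the affine monoid. -/
theorem exists_linear_part {f : toricRing K b} (hf : f ∈ gradedMaximalIdeal K b) :
    ∃ f₁ ∈ gradedMaximalIdeal K b, f - f₁ ∈ gradedMaximalIdeal K b ^ 2 ∧
      ∀ m ∈ f₁.1.support, m ∈ expMonoid b ∧ m ≠ 0 ∧ m ∉ powExps b 2 := by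
  have hf' : f ∈ standardSpan K b 2 ⊔ (gradedMaximalIdeal K b ^ 2).restrictScalars K := by
    rw [← ker_augmentation, standardSpan_sup_ker_pow]
    exact Submodule.mem_top
  obtain ⟨f₁, h1, f', h2, rfl⟩ := Submodule.mem_sup.1 hf'
  have h2' : f' ∈ gradedMaximalIdeal K b := Ideal.pow_le_self two_ne_zero h2
  have h3 : f₁ ∈ gradedMaximalIdeal K b := by
    have := sub_mem hf h2'
    rwa [add_sub_cancel_right] at this
  refine ⟨f₁, h3, ?_, fun m hm => ⟨mem_toricRing_iff.1 f₁.2 m hm, ?_, h1 m hm⟩⟩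
  · rw [add_sub_cancel_left]
    exact h2
  · rintro rfl
    exact mem_support_iff.1 hm (mem_gradedMaximalIdeal_iff.1 h3)

theorem squaresRigid_of_isSquarefreeToric {δ : ℕ} (hδ : 0 < δ) (ha : Function.Injective a)
    (hdeg : ∀ i, (a i).degree = δ) (hsq : IsSquarefreeToric K a) : SquaresRigid a := by
  classical
  obtain ⟨N, e, b, hb, ⟨φ⟩⟩ := hsq
  intro i k l hikl
  by_contra hki
  have hli : l ≠ i := by
    rintro rfl
    exact hki (ha (add_right_cancel hikl)).symm
  have hvrel : φ (toricGen K a i) * φ (toricGen K a i) =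
      φ (toricGen K a k) * φ (toricGen K a l) := by
    rw [← map_mul, ← map_mul]
    congr 1
    apply Subtype.ext
    change gen K a i * gen K a i = gen K a k * gen K a l
    rw [gen, gen, gen, monomial_mul, monomial_mul, hikl]
  have hind := fun x y (hxy : x ≠ y) c => translate_sub_smul_notMem_sq hδ ha hdeg φ hxy c
  have hgrel := translate_mul_self_eq (ε := augmentation K b)
    (v := fun i => φ (toricGen K a i)) (by
      rw [ker_augmentation]
      exact disjoint_polyLE_map hδ hdeg φ 1) hvrel
  have hgm := translate_mem_ker (augmentation K b) (fun i => φ (toricGen K a i))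
  rw [ker_augmentation] at hgm
  generalize translate (augmentation K b) (fun i => φ (toricGen K a i)) = g at hind hgrel hgm
  obtain ⟨f₁, hf1, hf2, hf3⟩ := exists_linear_part (hgm i)
  obtain ⟨g₁, hg1, hg2, hg3⟩ := exists_linear_part (hgm k)
  obtain ⟨h₁, hh1, hh2, hh3⟩ := exists_linear_part (hgm l)
  have hmem : f₁ * f₁ - g₁ * h₁ ∈ gradedMaximalIdeal K b ^ 3 := by
    have h1 : f₁ * f₁ - g₁ * h₁ = (g k * g l - g₁ * h₁) - (g i * g i - f₁ * f₁) := by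
      rw [hgrel]
      ring
    rw [h1]
    exact sub_mem (mul_sub_mul_mem_cube (hgm k) hg2 hh1 hh2)
      (mul_sub_mul_mem_cube (hgm i) hf2 hf1 hf2)
  -- Both products involve only sums of two irreducible exponents, none of which occurs in the cube,
  -- so the congruence is an equality.
  have hrel : f₁.1 * f₁.1 = g₁.1 * h₁.1 := by
    rw [← sub_eq_zero, ← support_eq_empty, Finset.eq_empty_iff_forall_notMem]
    intro m hm
    refine absurd (mem_gradedMaximalIdeal_pow_iff.1 hmem m hm) ?_
    rcases Finset.mem_union.1 (support_sub _ _ _ hm) with h | h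
    · obtain ⟨x, hx, y, hy, rfl⟩ := Finset.mem_add.1 (support_mul _ _ h)
      exact add_notMem_powExps_three hδ hdeg φ (hf3 x hx) (hf3 y hy)
    · obtain ⟨x, hx, y, hy, rfl⟩ := Finset.mem_add.1 (support_mul _ _ h)
      exact add_notMem_powExps_three hδ hdeg φ (hg3 x hx) (hh3 y hy)
  have haff : ∀ f : toricRing K b,
      (∀ m ∈ f.1.support, m ∈ expMonoid b ∧ m ≠ 0 ∧ m ∉ powExps b 2) →
      ∀ m ∈ f.1.support, ∀ s, m s ≤ 1 := by
    intro f hf m hm s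
    obtain ⟨h1, h2, h3⟩ := hf m hm
    obtain ⟨j, rfl⟩ := exists_eq_of_notMem_powExps_two h1 h2 h3
    exact hb j s
  -- Independence with scalar 0 says that g x is not in the square, so its linear part is nonzero.
  have hne : ∀ x, x ≠ i → ∀ x₁ : toricRing K b, g x - x₁ ∈ gradedMaximalIdeal K b ^ 2 →
      x₁.1 ≠ 0 := by
    intro x hx x₁ h1 h0
    have h0' : x₁ = 0 := Subtype.ext h0
    refine hind x i hx 0 ?_
    rw [zero_smul]
    rwa [h0'] at h1
  obtain ⟨c, hc⟩ := exists_eq_C_mul_of_sq_eq_mul (hne k hki _ hg2) (hne l hli _ hh2)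
    (haff g₁ hg3) (haff h₁ hh3) hrel
  have hc' : f₁ = c • g₁ := by
    apply Subtype.ext
    rw [hc, SetLike.val_smul, smul_eq_C_mul]
  refine hind i k (Ne.symm hki) c ?_
  have h1 : g i - c • g k = (g i - f₁) - c • (g k - g₁) := by
    rw [hc', smul_sub]
    abel
  rw [h1]
  exact sub_mem hf2 (Submodule.smul_of_tower_mem _ c hg2)

end Rigidity

end StronglyKoszulToric

theorem theorem2p3 {K : Type*} [Field K] {n d δ : ℕ} (hδ : 0 < δ) (a : Fin n → Fin d →₀ ℕ)
    (ha : Function.Injective a) (hdeg : ∀ i, (a i).degree = δ)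
    (hsq : StronglyKoszulToric.IsSquarefreeToric K a) :
    (StronglyKoszulToric.IsStronglyKoszul K a →
      ∀ i j : Fin n, i < j → ∀ ρ : Equiv.Perm (Fin n),
        StronglyKoszulToric.IsExchangeOrdering K a i j ρ →
          StronglyKoszulToric.QuadraticAt K a ρ i) ∧
    (StronglyKoszulToric.IsStronglyKoszul K a ↔
      ∀ i j : Fin n, i < j → ∃ (ρ : Equiv.Perm (Fin n)) (p q : Fin n),
        ({p, q} : Set (Fin n)) = {i, j} ∧ (ρ p : ℕ) = 0 ∧ (ρ q : ℕ) = 1 ∧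
          StronglyKoszulToric.QuadraticAt K a ρ q) := by
  have hr : StronglyKoszulToric.SquaresRigid a :=
    StronglyKoszulToric.squaresRigid_of_isSquarefreeToric hδ ha hdeg hsq
  have hfirst : StronglyKoszulToric.IsStronglyKoszul K a →
      ∀ i j : Fin n, i < j → ∀ ρ : Equiv.Perm (Fin n),
      StronglyKoszulToric.IsExchangeOrdering K a i j ρ →
        StronglyKoszulToric.QuadraticAt K a ρ i := by
    intro h i j hij ρ hρ
    rw [StronglyKoszulToric.quadraticAt_iff]
    exact fun e he hpos =>
      StronglyKoszulToric.degree_eq_two_of_minimal hδ hdeg (h.exchangeProperty hδ hdeg)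
        hr hij.ne hρ he hpos
  refine ⟨hfirst, fun h i j hij => ?_, fun h => ?_⟩
  · obtain ⟨ρ, hρ, hj, hi⟩ :=
      StronglyKoszulToric.exists_isExchangeOrdering (K := K) hr hδ hdeg hij.ne
    exact ⟨ρ, j, i, Set.pair_comm j i, hj, hi, hfirst h i j hij ρ hρ⟩
  · exact StronglyKoszulToric.isStronglyKoszul_of_exchangeProperty hδ ha hdeg
      (StronglyKoszulToric.exchangeProperty_of_quadraticAt hδ hdeg h)
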